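/- Let $K$ be a field, $n \ge 0$, and let $\Delta$ be a simplicial complex with vertex set $[n]=\{1,\dots,n\}$ (so every $\{i\}$, and also $\emptyset$, is a face). Let $R_\Delta = K[x_F t : F\in\Delta]$ be the $K$-subalgebra of the polynomial ring $K[x_1,\dots,x_n,t]$ generated by the monomials $x_F t$, where $x_F=\prod_{i\in F}x_i$; in particular $t=x_\emptyset t\in R_\Delta$. Let $S\subset\mathbb Z^{n+1}$ be the affine semigroup generated by the lattice points $p_F=\sum_{i\in F}e_i+e_{n+1}$, $F\in\Delta$, and let $\mathbb R_+S\subset\mathbb R^{n+1}$ be the smallest cone containing $S$. Suppose that $R_\Delta$ is normal (integrally closed in its field of fractions). Then the ideal $(t)$ of $R_\Delta$ has finitely many minimal primes, and if $r$ is their number, the divisor class group $\mathrm{Cl}(R_\Delta)$ is a free abelian group of rank $r-1$. Moreover, $r$ is also the number of facets of the cone $\mathbb R_+S$ that do not contain $e_{n+1}$. -/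

import Mathlib

noncomputable section

/-! ### The toric ring of a simplicial complex

`AbstractSimplicialComplex (Fin n)` is Mathlib's type of simplicial complexes with vertex set
`Fin n` (every singleton is a face). Mathlib lists only the nonempty faces, so the
empty face is put back in `allFaces`. -/

namespace ToricComplex

variable {n : ℕ}

/-- All faces of `Δ`, the empty face included. -/
def allFaces (Δ : AbstractSimplicialComplex (Fin n)) : Set (Finset (Fin n)) :=
  insert ∅ Δ.faces

/-- The monomial `x_F t` of `K[x_1, …, x_n, t]`. The variables `x_i` are those with
index `i.castSucc`, and `t` is the last variable. -/
def faceMonomial (K : Type*) [Field K] (F : Finset (Fin n)) : MvPolynomial (Fin (n + 1)) K :=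
  (∏ i ∈ F, MvPolynomial.X i.castSucc) * MvPolynomial.X (Fin.last n)

/-- The toric ring `R_Δ = K[x_F t : F ∈ Δ]`. -/
def toricRing (K : Type*) [Field K] (Δ : AbstractSimplicialComplex (Fin n)) :
    Subalgebra K (MvPolynomial (Fin (n + 1)) K) :=
  Algebra.adjoin K (faceMonomial K '' allFaces Δ)

/-- The element `t` of `R_Δ`, which corresponds to the empty face. -/
def tElem (K : Type*) [Field K] (Δ : AbstractSimplicialComplex (Fin n)) : toricRing K Δ :=
  ⟨faceMonomial K ∅, Algebra.subset_adjoin ⟨∅, Set.mem_insert _ _, rfl⟩⟩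

/-- The element `t` of `R_Δ` is the variable `t`. -/
theorem coe_tElem (K : Type*) [Field K] (Δ : AbstractSimplicialComplex (Fin n)) :
    (tElem K Δ : MvPolynomial (Fin (n + 1)) K) = MvPolynomial.X (Fin.last n) := by
  simp [tElem, faceMonomial]

/-! ### The affine semigroup and its cone -/

/-- The lattice point `p_F = ∑_{i ∈ F} e_i + e_{n+1}`. -/
def facePoint (F : Finset (Fin n)) : Fin (n + 1) → ℤ :=
  (∑ i ∈ F, Pi.single i.castSucc 1) + Pi.single (Fin.last n) 1

/-- The affine semigroup `S ⊆ ℤ^{n+1}` generated by the points `p_F`, `F ∈ Δ`. -/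
def affineSemigroup (Δ : AbstractSimplicialComplex (Fin n)) : AddSubmonoid (Fin (n + 1) → ℤ) :=
  AddSubmonoid.closure (facePoint '' allFaces Δ)

/-- The cone `ℝ_+ S ⊆ ℝ^{n+1}`. -/
def semigroupCone (Δ : AbstractSimplicialComplex (Fin n)) : PointedCone ℝ (Fin (n + 1) → ℝ) :=
  PointedCone.hull ℝ ((fun v : Fin (n + 1) → ℤ => fun j => (v j : ℝ)) '' (affineSemigroup Δ))

/-- `F` is a face of the cone `C`: the intersection of `C` with a supporting hyperplane `f = 0`
(such a hyperplane always meets `C`, in the origin). -/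
def IsConeFace {E : Type*} [AddCommGroup E] [Module ℝ E] (C : PointedCone ℝ E) (F : Set E) :
    Prop :=
  ∃ f : E →ₗ[ℝ] ℝ, f ≠ 0 ∧ (∀ x ∈ C, 0 ≤ f x) ∧ F = {x | x ∈ C ∧ f x = 0}

/-- A facet of `C` is a face of dimension `dim C - 1`; the dimension of a face is that of its
linear span. -/
def IsConeFacet {E : Type*} [AddCommGroup E] [Module ℝ E] (C : PointedCone ℝ E) (F : Set E) :
    Prop :=
  IsConeFace C F ∧
    Module.finrank ℝ (Submodule.span ℝ F) + 1 = Module.finrank ℝ (Submodule.span ℝ (C : Set E))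

/-- The facets of `ℝ_+ S` that do not contain `e_{n+1}`. -/
def facetsAvoidingLast (Δ : AbstractSimplicialComplex (Fin n)) : Set (Set (Fin (n + 1) → ℝ)) :=
  {F | IsConeFacet (semigroupCone Δ) F ∧ (Pi.single (Fin.last n) 1 : Fin (n + 1) → ℝ) ∉ F}

end ToricComplex

/-! ### The divisor class group of a Noetherian (normal) domain -/

namespace WeilDivisor

/-- The prime ideals of height one. -/
abbrev HeightOnePrime (R : Type*) [CommRing R] : Type _ :=
  {P : PrimeSpectrum R // P.asIdeal.height = 1}

/-- The divisor group `Div R`: the free abelian group on the height one primes. -/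
abbrev Divisor (R : Type*) [CommRing R] : Type _ := HeightOnePrime R →₀ ℤ

/-- The order of `a` at `P`, i.e. the length of `R_P / a R_P`. If `R_P` is a discrete valuation
ring, as is the case for normal Noetherian `R`, this is the `k` with `a R_P = P^k R_P`. -/
def ordAt {R : Type*} [CommRing R] (P : HeightOnePrime R) (a : R) : ℕ∞ :=
  Ring.ord (Localization.AtPrime P.1.asIdeal)
    (algebraMap R (Localization.AtPrime P.1.asIdeal) a)

/-- `D` is the divisor of the nonzero element `a / b` of the fraction field of `R`. -/
def IsDivOf {R : Type*} [CommRing R] (D : Divisor R) (a b : R) : Prop :=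
  ∀ P : HeightOnePrime R, ∃ k l : ℕ, ordAt P a = k ∧ ordAt P b = l ∧ D P = (k : ℤ) - l

theorem ordAt_one {R : Type*} [CommRing R] (P : HeightOnePrime R) : ordAt P (1 : R) = 0 := by
  simp [ordAt]

theorem ordAt_mul {R : Type*} [CommRing R] [IsDomain R] (P : HeightOnePrime R) (a : R) {b : R}
    (hb : b ≠ 0) : ordAt P (a * b) = ordAt P a + ordAt P b := by
  have hinj : Function.Injective (algebraMap R (Localization.AtPrime P.1.asIdeal)) :=
    IsLocalization.injective _ P.1.asIdeal.primeCompl_le_nonZeroDivisors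
  have : IsDomain (Localization.AtPrime P.1.asIdeal) :=
    IsLocalization.isDomain_localization P.1.asIdeal.primeCompl_le_nonZeroDivisors
  unfold ordAt
  rw [map_mul]
  refine Ring.ord_mul _ (mem_nonZeroDivisors_of_ne_zero ?_)
  exact fun h => hb (hinj (by rw [h, map_zero]))

/-- The subgroup of principal divisors. -/
def principal (R : Type*) [CommRing R] [IsDomain R] : AddSubgroup (Divisor R) where
  carrier := {D | ∃ a b : R, a ≠ 0 ∧ b ≠ 0 ∧ IsDivOf D a b}
  zero_mem' := ⟨1, 1, one_ne_zero, one_ne_zero,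
    fun P => ⟨0, 0, by simp [ordAt_one], by simp [ordAt_one], by simp⟩⟩
  add_mem' := by
    rintro D E ⟨a, b, ha, hb, hD⟩ ⟨c, d, hc, hd, hE⟩
    refine ⟨a * c, b * d, mul_ne_zero ha hc, mul_ne_zero hb hd, fun P => ?_⟩
    obtain ⟨k, l, hk, hl, h⟩ := hD P
    obtain ⟨k', l', hk', hl', h'⟩ := hE P
    refine ⟨k + k', l + l', ?_, ?_, ?_⟩
    · rw [ordAt_mul P a hc, hk, hk', Nat.cast_add]
    · rw [ordAt_mul P b hd, hl, hl', Nat.cast_add]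
    · rw [Finsupp.add_apply, h, h']
      push_cast
      ring
  neg_mem' := by
    rintro D ⟨a, b, ha, hb, hD⟩
    refine ⟨b, a, hb, ha, fun P => ?_⟩
    obtain ⟨k, l, hk, hl, h⟩ := hD P
    exact ⟨l, k, hl, hk, by rw [Finsupp.neg_apply, h]; ring⟩

/-- The divisor class group `Cl R`. (This is not Mathlib's `ClassGroup R`, which is the group of
invertible fractional ideals modulo principal ones.) -/
abbrev Cl (R : Type*) [CommRing R] [IsDomain R] : Type _ := Divisor R ⧸ principal R

end WeilDivisor

end

/-! The class group is computed by Nagata's method. Singletons are faces, so `x_i = (x_i t)/t` and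
inverting `t` turns `R_Δ` into `K[x_1, …, x_n, t, 1/t]`, which is factorial and whose units are
constants times powers of `t` (`exists_generator_away`, `exists_eq_unit_mul`). Hence `Cl` is
generated by the height one primes containing `t`, which are the minimal primes of `(t)`, and the
divisor of `t` generates their relations. If `t` has order one at some `P₀`, this relation
eliminates `P₀` and the other `r - 1` primes form a basis (`cl_free_of_localization`).

Such a `P₀` comes from a maximal vertex set `A` meeting every face at most once: the functional `h -
∑_{i ∈ A} x_i`, with `h` the last coordinate, is nonnegative on the cone, and its monomials of
positive weight generate a prime that is locally generated by `t` (`exists_natOrd_tElem_eq_one`).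

For the facets, the order at a minimal prime `P` of `(t)` is linear on monomials, so it defines a
functional nonnegative on the cone and positive at `e_{n+1}`. Rotating it to a facet functional only
enlarges its zero set, hence shrinks the associated monomial prime; that prime still contains `t`,
so it equals `P` (`exists_facet_of_mem_minimalPrimes`). Conversely, a facet avoiding `e_{n+1}` gives
a prime containing `t`; it lies over a minimal prime, again given by a facet, and nested facets
coincide (`bijOn_facetIdeal`). -/

noncomputable section

namespace WeilDivisor

/-! ### Orders at height one primes. -/

section Order

variable {R : Type*} [CommRing R]

/-- The order of `a` at `P` as a natural number (with junk value `0` if it is infinite). -/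
def natOrd (P : HeightOnePrime R) (a : R) : ℕ := (ordAt P a).toNat

theorem natOrd_eq_of_ordAt {P : HeightOnePrime R} {a : R} {k : ℕ} (h : ordAt P a = k) :
    natOrd P a = k := by
  simp [natOrd, h]

theorem ordAt_eq_zero {P : HeightOnePrime R} {a : R} (ha : a ∉ P.1.asIdeal) : ordAt P a = 0 :=
  Ring.ord_of_isUnit (IsLocalization.map_units (Localization.AtPrime P.1.asIdeal)
    (⟨a, ha⟩ : P.1.asIdeal.primeCompl))

theorem ordAt_ne_zero {P : HeightOnePrime R} {a : R} (ha : a ∈ P.1.asIdeal) : ordAt P a ≠ 0 := by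
  unfold ordAt Ring.ord
  rw [Ne, Module.length_eq_zero_iff, Submodule.Quotient.subsingleton_iff,
    Ideal.span_singleton_eq_top, IsLocalization.AtPrime.isUnit_to_map_iff _ P.1.asIdeal]
  exact fun h => h ha

theorem natOrd_one (P : HeightOnePrime R) : natOrd P (1 : R) = 0 :=
  natOrd_eq_of_ordAt (ordAt_one P)

/-- An element generating `P` locally has order one at `P`. -/
theorem natOrd_eq_one {P : HeightOnePrime R} {x : R} (hx : x ∈ P.1.asIdeal)
    (h : ∀ r ∈ P.1.asIdeal, ∃ u ∉ P.1.asIdeal, x ∣ u * r) : natOrd P x = 1 := by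
  apply natOrd_eq_of_ordAt
  have hmax : Ideal.span {algebraMap R (Localization.AtPrime P.1.asIdeal) x} =
      IsLocalRing.maximalIdeal (Localization.AtPrime P.1.asIdeal) := by
    apply le_antisymm
    · rw [Ideal.span_singleton_le_iff_mem, IsLocalization.AtPrime.to_map_mem_maximal_iff _
        P.1.asIdeal]
      exact hx
    · rw [← Localization.AtPrime.map_eq_maximalIdeal, Ideal.map_le_iff_le_comap]
      intro r hr
      obtain ⟨u, hu, hd⟩ := h r hr
      rw [Ideal.mem_comap, Ideal.mem_span_singleton]
      have hunit := IsLocalization.map_units (Localization.AtPrime P.1.asIdeal)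
        (⟨u, hu⟩ : P.1.asIdeal.primeCompl)
      have := (algebraMap R (Localization.AtPrime P.1.asIdeal)).map_dvd hd
      rw [map_mul] at this
      exact (hunit.dvd_mul_left).1 this
  have hM : (Ideal.span {algebraMap R (Localization.AtPrime P.1.asIdeal) x}).IsMaximal := by
    rw [hmax]; infer_instance
  -- The quotient by `x` is the residue field, which has length one.
  unfold ordAt Ring.ord
  rw [Nat.cast_one, Module.length_eq_one_iff]
  exact isSimpleModule_iff_isCoatom.2 hM.out

variable [IsDomain R]

/-- Krull's principal ideal theorem bounds the height by one; in a domain only the zero ideal has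
height zero. -/
theorem height_eq_one_of_mem_minimalPrimes [IsNoetherianRing R] {a : R} (ha : a ≠ 0) {P : Ideal R}
    (hP : P ∈ (Ideal.span {a}).minimalPrimes) : P.height = 1 := by
  have := hP.1.1
  refine le_antisymm (Ideal.height_le_one_of_isPrincipal_of_mem_minimalPrimes _ P hP) ?_
  rw [Order.one_le_iff_ne_zero, Ne, Ideal.height_eq_zero_iff_eq_bot]
  rintro rfl
  exact ha (by simpa using hP.1.2)

theorem eq_of_le_heightOnePrime {P : HeightOnePrime R} {J : Ideal R} [hJ : J.IsPrime] (h0 : J ≠ ⊥)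
    (h : J ≤ P.1.asIdeal) : J = P.1.asIdeal := by
  by_contra hne
  have h1 : J.height + 1 ≤ P.1.asIdeal.height :=
    Ideal.height_add_one_le_of_lt_of_isPrime (lt_of_le_of_ne h hne)
  rw [P.2] at h1
  have h2 : J.height ≠ 0 := fun h => h0 (Ideal.height_eq_zero_iff_eq_bot.1 h)
  have h3 : (1 : ℕ∞) ≤ J.height := Order.one_le_iff_ne_zero.2 h2
  have h4 : (1 : ℕ∞) + 1 ≤ 1 := le_trans (by gcongr) h1
  exact absurd h4 (by decide)

theorem mem_minimalPrimes_of_mem {P : HeightOnePrime R} {a : R} (ha : a ≠ 0)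
    (h : a ∈ P.1.asIdeal) : P.1.asIdeal ∈ (Ideal.span {a}).minimalPrimes := by
  refine ⟨⟨P.1.2, by simpa [Ideal.span_le] using h⟩, fun J ⟨hJ, haJ⟩ hJP => ?_⟩
  have haJ' : a ∈ J := haJ (Ideal.mem_span_singleton_self a)
  exact (eq_of_le_heightOnePrime (hJ := hJ) (fun h => ha (by simpa [h] using haJ')) hJP).ge

variable [IsNoetherianRing R]

theorem finite_heightOnePrime_mem {a : R} (ha : a ≠ 0) :
    {P : HeightOnePrime R | a ∈ P.1.asIdeal}.Finite := by
  refine Set.Finite.of_finite_image (f := fun P => P.1.asIdeal) ?_ ?_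
  · refine ((Ideal.span {a}).finite_minimalPrimes_of_isNoetherianRing R).subset ?_
    rintro _ ⟨P, hP, rfl⟩
    exact mem_minimalPrimes_of_mem ha hP
  · intro P _ Q _ h
    exact Subtype.ext (PrimeSpectrum.ext h)

/-- The local ring is a Noetherian domain of dimension at most one, so its quotient by a nonzero
element has finite length. -/
theorem ordAt_ne_top (P : HeightOnePrime R) {a : R} (ha : a ≠ 0) : ordAt P a ≠ ⊤ := by
  have hinj : Function.Injective (algebraMap R (Localization.AtPrime P.1.asIdeal)) :=
    IsLocalization.injective _ P.1.asIdeal.primeCompl_le_nonZeroDivisors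
  have : IsDomain (Localization.AtPrime P.1.asIdeal) :=
    IsLocalization.isDomain_localization P.1.asIdeal.primeCompl_le_nonZeroDivisors
  have : IsNoetherianRing (Localization.AtPrime P.1.asIdeal) :=
    IsLocalization.isNoetherianRing P.1.asIdeal.primeCompl _ inferInstance
  have : Ring.KrullDimLE 1 (Localization.AtPrime P.1.asIdeal) := by
    rw [Ring.KrullDimLE, Order.krullDimLE_iff]
    have := IsLocalization.AtPrime.ringKrullDim_eq_height P.1.asIdeal
      (Localization.AtPrime P.1.asIdeal)
    rw [P.2] at this
    exact this.le
  exact Ring.ord_ne_top (mem_nonZeroDivisors_of_ne_zero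
    ((map_ne_zero_iff _ hinj).2 ha))

theorem coe_natOrd (P : HeightOnePrime R) {a : R} (ha : a ≠ 0) :
    (natOrd P a : ℕ∞) = ordAt P a :=
  ENat.natCast_toNat (ordAt_ne_top P ha)

theorem natOrd_mul (P : HeightOnePrime R) {a b : R} (ha : a ≠ 0) (hb : b ≠ 0) :
    natOrd P (a * b) = natOrd P a + natOrd P b := by
  apply natOrd_eq_of_ordAt
  rw [ordAt_mul P a hb, ← coe_natOrd P ha, ← coe_natOrd P hb, Nat.cast_add]

theorem natOrd_pow (P : HeightOnePrime R) {a : R} (ha : a ≠ 0) (k : ℕ) :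
    natOrd P (a ^ k) = k * natOrd P a := by
  induction k with
  | zero => simp [natOrd_one]
  | succ k ih => rw [pow_succ, natOrd_mul P (pow_ne_zero k ha) ha, ih]; ring

theorem natOrd_eq_zero_iff {P : HeightOnePrime R} {a : R} (ha : a ≠ 0) :
    natOrd P a = 0 ↔ a ∉ P.1.asIdeal := by
  refine ⟨fun h hP => ordAt_ne_zero hP ?_, fun h => natOrd_eq_of_ordAt (ordAt_eq_zero h)⟩
  rw [← coe_natOrd P ha, h, Nat.cast_zero]

theorem natOrd_isUnit {P : HeightOnePrime R} {a : R} (ha : IsUnit a) : natOrd P a = 0 :=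
  (natOrd_eq_zero_iff ha.ne_zero).2 fun h => P.1.2.ne_top (Ideal.eq_top_of_isUnit_mem _ h ha)

/-- The divisor of a nonzero element. -/
def divOf (a : R) (ha : a ≠ 0) : Divisor R :=
  Finsupp.ofSupportFinite (fun P => (natOrd P a : ℤ)) <| by
    refine (finite_heightOnePrime_mem ha).subset fun P hP => ?_
    by_contra h
    exact hP (by simpa using (natOrd_eq_zero_iff ha).2 h)

theorem divOf_apply {a : R} (ha : a ≠ 0) (P : HeightOnePrime R) : divOf a ha P = natOrd P a := rfl

theorem divOf_mem_principal {a : R} (ha : a ≠ 0) : divOf a ha ∈ principal R :=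
  ⟨a, 1, ha, one_ne_zero, fun P => ⟨natOrd P a, 0, (coe_natOrd P ha).symm, by
    simp [ordAt_one], by simp [divOf_apply]⟩⟩

end Order

/-! ### Nagata's theorem: the class group from the primes containing `t`. -/

section Nagata

variable {R : Type*} [CommRing R] [IsDomain R] [IsNoetherianRing R] {t : R}

/-- The height one primes containing `t`, other than a chosen one. -/
abbrev OtherPrimes (t : R) (P₀ : HeightOnePrime R) : Type _ :=
  {P : HeightOnePrime R // t ∈ P.1.asIdeal ∧ P ≠ P₀}

/-- The class of a divisor supported on `OtherPrimes t P₀`. -/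
def classOfOther (t : R) (P₀ : HeightOnePrime R) : (OtherPrimes t P₀ →₀ ℤ) →+ Cl R :=
  (QuotientAddGroup.mk' (principal R)).comp (Finsupp.mapDomain.addMonoidHom Subtype.val)

/-- If `D = div(a/b)`, then `a` and `b` agree in order at all primes away from `t`, so `a/b` is a
unit times a power of `t`. Since `D` vanishes at `P₀`, where `t` has order one, the exponent is
zero, and so is `D`. -/
theorem classOfOther_injective {P₀ : HeightOnePrime R} (ht : t ≠ 0)
    (hP₀ : natOrd P₀ t = 1)
    (hunit : ∀ a b : R, a ≠ 0 → b ≠ 0 →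
      (∀ Q : HeightOnePrime R, t ∉ Q.1.asIdeal → natOrd Q a = natOrd Q b) →
      ∃ (i j : ℕ) (u : R), IsUnit u ∧ t ^ i * a = u * (t ^ j * b)) :
    Function.Injective (classOfOther t P₀) := by
  rw [injective_iff_map_eq_zero]
  intro D hD
  have hmem : Finsupp.mapDomain Subtype.val D ∈ principal R := by
    rw [← QuotientAddGroup.eq_zero_iff]; exact hD
  obtain ⟨a, b, ha, hb, hdiv⟩ := hmem
  have hval (P : HeightOnePrime R) :
      Finsupp.mapDomain Subtype.val D P = (natOrd P a : ℤ) - natOrd P b := by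
    obtain ⟨k, l, hk, hl, h⟩ := hdiv P
    rw [h, natOrd_eq_of_ordAt hk, natOrd_eq_of_ordAt hl]
  have hzero (P : HeightOnePrime R) (hP : ¬ (t ∈ P.1.asIdeal ∧ P ≠ P₀)) :
      natOrd P a = natOrd P b := by
    have h := hval P
    rw [Finsupp.mapDomain_of_notMem_range _ _ (by simpa using hP)] at h
    omega
  obtain ⟨i, j, u, hu, he⟩ := hunit a b ha hb fun Q hQ => hzero Q fun h => hQ h.1
  have hord (P : HeightOnePrime R) :
      i * natOrd P t + natOrd P a = j * natOrd P t + natOrd P b := by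
    have := congrArg (natOrd P) he
    rwa [natOrd_mul P (pow_ne_zero _ ht) ha, natOrd_mul P hu.ne_zero
      (mul_ne_zero (pow_ne_zero _ ht) hb), natOrd_mul P (pow_ne_zero _ ht) hb, natOrd_pow P ht,
      natOrd_pow P ht, natOrd_isUnit hu, zero_add] at this
  have hij : i = j := by
    have h1 := hord P₀
    have h2 := hzero P₀ (by simp)
    rw [hP₀] at h1
    omega
  ext P
  have h1 := hval P.1
  rw [Finsupp.mapDomain_apply Subtype.val_injective] at h1
  have h2 := hord P.1
  rw [hij] at h2
  rw [h1, Finsupp.zero_apply]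
  omega

/-- The divisor of `t` expresses the class of `P₀` through the other primes over `t`. A prime `Q`
away from `t` is, up to primes over `t`, the divisor of its local generator `q`. -/
theorem classOfOther_surjective {P₀ : HeightOnePrime R} (ht : t ≠ 0) (hP₀ : natOrd P₀ t = 1)
    (hprin : ∀ Q : HeightOnePrime R, t ∉ Q.1.asIdeal → ∃ q : R, q ≠ 0 ∧ natOrd Q q = 1 ∧
      ∀ Q' : HeightOnePrime R, t ∉ Q'.1.asIdeal → q ∈ Q'.1.asIdeal → Q' = Q) :
    Function.Surjective (classOfOther t P₀) := by
  let S := (classOfOther t P₀).range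
  have hsupp (E : Divisor R) (hE : ∀ P, ¬ (t ∈ P.1.asIdeal ∧ P ≠ P₀) → E P = 0) :
      (QuotientAddGroup.mk' (principal R)) E ∈ S := by
    refine ⟨E.comapDomain Subtype.val Subtype.val_injective.injOn, ?_⟩
    change QuotientAddGroup.mk' (principal R) (Finsupp.mapDomain _ _) = _
    rw [Finsupp.mapDomain_comapDomain _ Subtype.val_injective]
    intro P hP
    by_contra h
    exact (Finsupp.mem_support_iff.1 hP) (hE P (by simpa using h))
  have hdiv {a : R} (ha : a ≠ 0) : QuotientAddGroup.mk' (principal R) (divOf a ha) = 0 :=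
    (QuotientAddGroup.eq_zero_iff _).2 (divOf_mem_principal ha)
  have hbase : QuotientAddGroup.mk' (principal R) (Finsupp.single P₀ 1) ∈ S := by
    have h := hsupp (divOf t ht - Finsupp.single P₀ 1) fun P hP => ?_
    · rw [map_sub, hdiv, zero_sub] at h
      exact neg_mem_iff.1 h
    · rw [Finsupp.sub_apply, divOf_apply]
      by_cases h : P = P₀
      · subst h; simp [hP₀]
      · have : t ∉ P.1.asIdeal := fun h' => hP ⟨h', h⟩
        rw [(natOrd_eq_zero_iff ht).2 this, Finsupp.single_eq_of_ne h]
        simp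
  have hsingle (Q : HeightOnePrime R) :
      QuotientAddGroup.mk' (principal R) (Finsupp.single Q 1) ∈ S := by
    by_cases hQ : t ∈ Q.1.asIdeal
    · by_cases h : Q = P₀
      · rw [h]; exact hbase
      · refine hsupp _ fun P hP => ?_
        rw [Finsupp.single_eq_of_ne]
        rintro rfl
        exact hP ⟨hQ, h⟩
    · obtain ⟨q, hq0, hq1, hq⟩ := hprin Q hQ
      have hQP : Q ≠ P₀ := by
        rintro rfl
        rw [(natOrd_eq_zero_iff ht).2 hQ] at hP₀
        exact zero_ne_one hP₀
      -- Subtracting the contributions of `Q` and `P₀` leaves a divisor supported on the remaining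
      -- primes over `t`.
      have h := hsupp (divOf q hq0 - Finsupp.single Q 1 -
        (natOrd P₀ q : ℤ) • Finsupp.single P₀ 1) fun P hP => ?_
      · rw [map_sub, map_sub, hdiv, zero_sub, map_zsmul] at h
        have := add_mem h (S.zsmul_mem hbase (natOrd P₀ q))
        rw [sub_add_cancel] at this
        exact neg_mem_iff.1 this
      · rw [Finsupp.sub_apply, Finsupp.sub_apply, divOf_apply, Finsupp.smul_apply]
        by_cases h : P = P₀
        · subst h; simp [hQP]
        · have htP : t ∉ P.1.asIdeal := fun h' => hP ⟨h', h⟩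
          by_cases hPQ : P = Q
          · subst hPQ; simp [hq1, Ne.symm h]
          · rw [(natOrd_eq_zero_iff hq0).2 fun hqP => hPQ (hq P htP hqP)]
            simp [Ne.symm h, Ne.symm hPQ]
  intro c
  obtain ⟨D, rfl⟩ := QuotientAddGroup.mk'_surjective (principal R) c
  change _ ∈ S
  induction D using Finsupp.induction_linear with
  | zero => rw [map_zero]; exact zero_mem _
  | add f g hf hg => rw [map_add]; exact add_mem hf hg
  | single Q k =>
    have : (Finsupp.single Q k : Divisor R) = k • Finsupp.single Q 1 := by simp
    rw [this, map_zsmul]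
    exact S.zsmul_mem (hsingle Q) k

theorem natCard_otherPrimes_add_one {P₀ : HeightOnePrime R} (ht : t ≠ 0)
    (hP₀ : t ∈ P₀.1.asIdeal) :
    Nat.card (OtherPrimes t P₀) + 1 = (Ideal.span {t}).minimalPrimes.ncard := by
  have himg : (Ideal.span {t}).minimalPrimes =
      (fun P : HeightOnePrime R => P.1.asIdeal) '' {P | t ∈ P.1.asIdeal} := by
    ext P
    constructor
    · intro hP
      exact ⟨⟨⟨P, hP.1.1⟩, height_eq_one_of_mem_minimalPrimes ht hP⟩,
        hP.1.2 (Ideal.mem_span_singleton_self t), rfl⟩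
    · rintro ⟨P, hP, rfl⟩
      exact mem_minimalPrimes_of_mem ht hP
  rw [himg, Set.ncard_image_of_injective _ fun P Q h => Subtype.ext (PrimeSpectrum.ext h),
    ← Set.ncard_sdiff_singleton_add_one (a := P₀) hP₀ (finite_heightOnePrime_mem ht)]
  rfl

/-- **Nagata's theorem**, when inverting `t` gives a factorial ring whose units are, up to units of
`R`, powers of `t`, and `t` has order one at some prime. -/
theorem cl_free_of_localization {P₀ : HeightOnePrime R} (ht : t ≠ 0) (hP₀ : natOrd P₀ t = 1)
    (hunit : ∀ a b : R, a ≠ 0 → b ≠ 0 →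
      (∀ Q : HeightOnePrime R, t ∉ Q.1.asIdeal → natOrd Q a = natOrd Q b) →
      ∃ (i j : ℕ) (u : R), IsUnit u ∧ t ^ i * a = u * (t ^ j * b))
    (hprin : ∀ Q : HeightOnePrime R, t ∉ Q.1.asIdeal → ∃ q : R, q ≠ 0 ∧ natOrd Q q = 1 ∧
      ∀ Q' : HeightOnePrime R, t ∉ Q'.1.asIdeal → q ∈ Q'.1.asIdeal → Q' = Q) :
    Module.Free ℤ (Cl R) ∧ Module.Finite ℤ (Cl R) ∧
      Module.finrank ℤ (Cl R) + 1 = (Ideal.span {t}).minimalPrimes.ncard := by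
  have htP₀ : t ∈ P₀.1.asIdeal := by
    by_contra h
    rw [(natOrd_eq_zero_iff ht).2 h] at hP₀
    exact zero_ne_one hP₀
  have : Finite (OtherPrimes t P₀) :=
    ((finite_heightOnePrime_mem ht).subset 
      (show {P : HeightOnePrime R | t ∈ P.1.asIdeal ∧ P ≠ P₀} ⊆ _ from fun P hP => hP.1)).to_subtype
  have := Fintype.ofFinite (OtherPrimes t P₀)
  let e : (OtherPrimes t P₀ →₀ ℤ) ≃ₗ[ℤ] Cl R :=
    LinearEquiv.ofBijective (classOfOther t P₀).toIntLinearMap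
      ⟨classOfOther_injective ht hP₀ hunit, classOfOther_surjective ht hP₀ hprin⟩
  refine ⟨Module.Free.of_equiv e, Module.Finite.equiv e, ?_⟩
  rw [← e.finrank_eq, Module.finrank_finsupp_self, ← Nat.card_eq_fintype_card,
    natCard_otherPrimes_add_one ht htP₀]

end Nagata

end WeilDivisor

end

noncomputable section

namespace ToricComplex

open WeilDivisor MvPolynomial

variable {n : ℕ} {K : Type*} [Field K] {Δ : AbstractSimplicialComplex (Fin n)}

theorem empty_mem_allFaces : ∅ ∈ allFaces Δ := Set.mem_insert _ _

theorem singleton_mem_allFaces (i : Fin n) : {i} ∈ allFaces Δ :=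
  Set.mem_insert_of_mem _ (Δ.singleton_mem i)

theorem mem_allFaces_of_subset {F G : Finset (Fin n)} (hF : F ∈ allFaces Δ) (h : G ⊆ F) :
    G ∈ allFaces Δ := by
  rcases hF with rfl | hF
  · rw [Finset.subset_empty.1 h]; exact empty_mem_allFaces
  · rcases G.eq_empty_or_nonempty with rfl | hG
    · exact empty_mem_allFaces
    · exact Set.mem_insert_of_mem _ ((Δ.isRelLowerSet_faces hF).2 h hG)

theorem finite_allFaces : (allFaces Δ).Finite := Set.toFinite _

instance : IsNoetherianRing (toricRing K Δ) := by
  have : Algebra.FiniteType K (toricRing K Δ) :=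
    Subalgebra.fg_iff_finiteType _ |>.1 <| Subalgebra.fg_def.2
      ⟨_, finite_allFaces.image _, rfl⟩
  exact Algebra.FiniteType.isNoetherianRing K _

theorem faceMonomial_mem {F : Finset (Fin n)} (hF : F ∈ allFaces Δ) :
    faceMonomial K F ∈ toricRing K Δ :=
  Algebra.subset_adjoin ⟨F, hF, rfl⟩

theorem tElem_ne_zero : tElem K Δ ≠ 0 := by
  intro h
  have := congrArg Subtype.val h
  rw [coe_tElem] at this
  exact X_ne_zero _ this

/-! ### Inverting `t`: comparison with the polynomial ring. -/

section Localization

/-- Each variable `x_i` becomes the generator `x_i t` after multiplication by `t`, so powers of `t`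
clear all denominators. -/
theorem exists_pow_mul_mem (p : MvPolynomial (Fin (n + 1)) K) :
    ∃ (N : ℕ) (s : toricRing K Δ), (s : MvPolynomial (Fin (n + 1)) K) = X (Fin.last n) ^ N * p := by
  induction p using MvPolynomial.induction_on with
  | C a => exact ⟨0, algebraMap K _ a, by simp [algebraMap_eq]⟩
  | add p q hp hq =>
    obtain ⟨N, s, hs⟩ := hp
    obtain ⟨M, r, hr⟩ := hq
    refine ⟨N + M, tElem K Δ ^ M * s + tElem K Δ ^ N * r, ?_⟩
    push_cast
    rw [hs, hr, coe_tElem]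
    ring
  | mul_X p i hp =>
    obtain ⟨N, s, hs⟩ := hp
    induction i using Fin.lastCases with
    | last => exact ⟨N, s * tElem K Δ, by push_cast; rw [hs, coe_tElem]; ring⟩
    | cast i =>
      refine ⟨N + 1, s * ⟨_, faceMonomial_mem (singleton_mem_allFaces i)⟩, ?_⟩
      push_cast
      rw [hs, faceMonomial, Finset.prod_singleton]
      ring

/-- The contraction to `R_Δ` of the ideal of the polynomial ring generated by `q`. -/
def contraction (Δ : AbstractSimplicialComplex (Fin n)) (q : MvPolynomial (Fin (n + 1)) K) :
    Ideal (toricRing K Δ) :=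
  (Ideal.span {q}).comap (toricRing K Δ).val

theorem mem_contraction {q : MvPolynomial (Fin (n + 1)) K} {r : toricRing K Δ} :
    r ∈ contraction Δ q ↔ q ∣ (r : MvPolynomial (Fin (n + 1)) K) := by
  rw [contraction, Ideal.mem_comap, Ideal.mem_span_singleton]
  rfl

theorem isPrime_contraction {q : MvPolynomial (Fin (n + 1)) K} (hq : Prime q) :
    (contraction Δ q).IsPrime := by
  have := (Ideal.span_singleton_prime hq.ne_zero).2 hq
  exact Ideal.comap_isPrime _ _

/-- A multiple `q p` lying in `R_Δ` becomes a multiple of `s` inside `R_Δ` after multiplication by a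
power of `t`, and `t` can be cancelled modulo `Q`. -/
theorem contraction_le {q : MvPolynomial (Fin (n + 1)) K} {Q : Ideal (toricRing K Δ)}
    [hQ : Q.IsPrime] (ht : tElem K Δ ∉ Q) {N : ℕ} {s : toricRing K Δ}
    (hs : (s : MvPolynomial (Fin (n + 1)) K) = X (Fin.last n) ^ N * q) (hsQ : s ∈ Q) :
    contraction Δ q ≤ Q := by
  intro r hr
  obtain ⟨p, hp⟩ := mem_contraction.1 hr
  obtain ⟨M, v, hv⟩ := exists_pow_mul_mem (Δ := Δ) p
  have h : tElem K Δ ^ (N + M) * r = s * v := by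
    apply Subtype.ext
    push_cast
    rw [hs, hv, hp, coe_tElem]
    ring
  have : tElem K Δ ^ (N + M) * r ∈ Q := h ▸ Q.mul_mem_right _ hsQ
  exact (hQ.mem_or_mem this).resolve_left fun h => ht (hQ.mem_of_pow_mem _ h)

theorem exists_prime_contraction_le {Q : Ideal (toricRing K Δ)} [hQ : Q.IsPrime]
    (ht : tElem K Δ ∉ Q) (h0 : Q ≠ ⊥) :
    ∃ (q : MvPolynomial (Fin (n + 1)) K) (N : ℕ) (s : toricRing K Δ), Prime q ∧
      (s : MvPolynomial (Fin (n + 1)) K) = X (Fin.last n) ^ N * q ∧ s ∈ Q := by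
  obtain ⟨r, hrQ, hr0⟩ := Submodule.exists_mem_ne_zero_of_ne_bot h0
  -- Factors of an element of `R_Δ` need not lie in `R_Δ`, so the induction runs over polynomials
  -- `p` with `t ^ N * p ∈ Q`.
  suffices H : ∀ p : MvPolynomial (Fin (n + 1)) K, p ≠ 0 → ∀ (N : ℕ) (s : toricRing K Δ),
      (s : MvPolynomial (Fin (n + 1)) K) = X (Fin.last n) ^ N * p → s ∈ Q →
      ∃ (q : MvPolynomial (Fin (n + 1)) K) (N : ℕ) (s : toricRing K Δ), Prime q ∧
        (s : MvPolynomial (Fin (n + 1)) K) = X (Fin.last n) ^ N * q ∧ s ∈ Q from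
    H r (by simpa using hr0) 0 r (by simp) hrQ
  intro p
  induction p using UniqueFactorizationMonoid.induction_on_prime with
  | h₁ => exact fun h => absurd rfl h
  | h₂ p hp =>
    intro _ N s hs hsQ
    obtain ⟨c, hc, rfl⟩ := isUnit_iff_eq_C_of_isReduced.1 hp
    have h : s = tElem K Δ ^ N * algebraMap K _ c := by
      apply Subtype.ext
      push_cast
      rw [hs, coe_tElem]
      rfl
    rw [h] at hsQ
    rcases hQ.mem_or_mem hsQ with h | h
    · exact absurd (hQ.mem_of_pow_mem _ h) ht
    · exact absurd (Ideal.eq_top_of_isUnit_mem _ h (hc.map _)) hQ.ne_top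
  | h₃ p q hp0 hq ih =>
    intro _ N s hs hsQ
    obtain ⟨a, u, hu⟩ := exists_pow_mul_mem (Δ := Δ) q
    obtain ⟨b, v, hv⟩ := exists_pow_mul_mem (Δ := Δ) p
    have h : tElem K Δ ^ N * (u * v) = tElem K Δ ^ (a + b) * s := by
      apply Subtype.ext
      push_cast
      rw [hu, hv, hs, coe_tElem]
      ring
    have h' : tElem K Δ ^ N * (u * v) ∈ Q := h ▸ Q.mul_mem_left _ hsQ
    rcases hQ.mem_or_mem h' with h | h
    · exact absurd (hQ.mem_of_pow_mem _ h) ht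
    · rcases hQ.mem_or_mem h with h | h
      · exact ⟨q, a, u, hq, hu, h⟩
      · exact ih hp0 b v hv h

theorem tElem_notMem_contraction {q : MvPolynomial (Fin (n + 1)) K}
    (hqt : ¬ q ∣ X (Fin.last n)) : tElem K Δ ∉ contraction Δ q := by
  rwa [mem_contraction, coe_tElem]

/-- By `contraction_le`, this prime is minimal over the single element `t ^ N * q`. -/
theorem height_contraction {q : MvPolynomial (Fin (n + 1)) K} (hq : Prime q)
    (hqt : ¬ q ∣ X (Fin.last n)) : (contraction Δ q).height = 1 := by
  obtain ⟨N, s, hs⟩ := exists_pow_mul_mem (Δ := Δ) q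
  have hs0 : s ≠ 0 := by
    rintro rfl
    exact mul_ne_zero (pow_ne_zero N (X_ne_zero _)) hq.ne_zero hs.symm
  refine height_eq_one_of_mem_minimalPrimes hs0 ⟨⟨isPrime_contraction hq, ?_⟩, ?_⟩
  · rw [Ideal.span_singleton_le_iff_mem, mem_contraction, hs]
    exact dvd_mul_left _ _
  · rintro J ⟨hJ, hsJ⟩ hJQ
    exact contraction_le (fun h => tElem_notMem_contraction hqt (hJQ h)) hs
      (hsJ (Ideal.mem_span_singleton_self s))

/-- The height one prime of `R_Δ` below a prime element `q` not dividing `t`. -/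
def contractionPrime (Δ : AbstractSimplicialComplex (Fin n)) {q : MvPolynomial (Fin (n + 1)) K}
    (hq : Prime q) (hqt : ¬ q ∣ X (Fin.last n)) : HeightOnePrime (toricRing K Δ) :=
  ⟨⟨contraction Δ q, isPrime_contraction hq⟩, height_contraction hq hqt⟩

theorem tElem_notMem_contractionPrime {q : MvPolynomial (Fin (n + 1)) K} (hq : Prime q)
    (hqt : ¬ q ∣ X (Fin.last n)) : tElem K Δ ∉ (contractionPrime Δ hq hqt).1.asIdeal :=
  tElem_notMem_contraction hqt

theorem natOrd_contractionPrime_eq_one {q : MvPolynomial (Fin (n + 1)) K} (hq : Prime q)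
    (hqt : ¬ q ∣ X (Fin.last n)) {N : ℕ} {s : toricRing K Δ}
    (hs : (s : MvPolynomial (Fin (n + 1)) K) = X (Fin.last n) ^ N * q) :
    natOrd (contractionPrime Δ hq hqt) s = 1 := by
  refine natOrd_eq_one (mem_contraction.2 (hs ▸ dvd_mul_left _ _)) fun r hr => ?_
  obtain ⟨p, hp⟩ := mem_contraction.1 hr
  obtain ⟨M, v, hv⟩ := exists_pow_mul_mem (Δ := Δ) p
  refine ⟨tElem K Δ ^ (N + M), fun h => tElem_notMem_contractionPrime hq hqt
    ((contractionPrime Δ hq hqt).1.2.mem_of_pow_mem _ h), v, ?_⟩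
  apply Subtype.ext
  push_cast
  rw [hs, hv, hp, coe_tElem]
  ring

/-- Away from `t` the order is the `q`-adic valuation: up to powers of `t`, `a` is `s ^ k * v` with
`s` of order one, while `t` and `v` have order zero. -/
theorem natOrd_contractionPrime {q : MvPolynomial (Fin (n + 1)) K} (hq : Prime q)
    (hqt : ¬ q ∣ X (Fin.last n)) {a : toricRing K Δ} (ha : a ≠ 0) :
    (natOrd (contractionPrime Δ hq hqt) a : ℕ∞) =
      emultiplicity q (a : MvPolynomial (Fin (n + 1)) K) := by
  have ha' : (a : MvPolynomial (Fin (n + 1)) K) ≠ 0 := by simpa using ha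
  have hfin : FiniteMultiplicity q (a : MvPolynomial (Fin (n + 1)) K) :=
    FiniteMultiplicity.of_prime_left hq ha'
  obtain ⟨c, hc, hqc⟩ := hfin.exists_eq_pow_mul_and_not_dvd
  rw [hfin.emultiplicity_eq_multiplicity]
  set k := multiplicity q (a : MvPolynomial (Fin (n + 1)) K)
  obtain ⟨N, s, hs⟩ := exists_pow_mul_mem (Δ := Δ) q
  obtain ⟨M, v, hv⟩ := exists_pow_mul_mem (Δ := Δ) c
  have h : tElem K Δ ^ (N * k + M) * a = s ^ k * v := by
    apply Subtype.ext
    push_cast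
    rw [hs, hv, hc, coe_tElem]
    ring
  have hs1 := natOrd_contractionPrime_eq_one hq hqt hs
  have hs0 : s ≠ 0 := by
    rintro rfl
    exact mul_ne_zero (pow_ne_zero N (X_ne_zero _)) hq.ne_zero hs.symm
  have hvP : v ∉ (contractionPrime Δ hq hqt).1.asIdeal := by
    intro hvP
    have := mem_contraction.1 hvP
    rw [hv] at this
    rcases hq.dvd_or_dvd this with h | h
    · exact hqt (hq.dvd_of_dvd_pow h)
    · exact hqc h
  have hv0 : v ≠ 0 := fun h => hvP (h ▸ Ideal.zero_mem _)
  have h' := congrArg (natOrd (contractionPrime Δ hq hqt)) h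
  have ht0 : tElem K Δ ≠ 0 := tElem_ne_zero
  rw [natOrd_mul _ (pow_ne_zero _ ht0) ha, natOrd_mul _ (pow_ne_zero _ hs0) hv0,
    natOrd_pow _ ht0, natOrd_pow _ hs0, hs1, (natOrd_eq_zero_iff hv0).2 hvP,
    (natOrd_eq_zero_iff ht0).2 (tElem_notMem_contractionPrime hq hqt)] at h'
  norm_cast
  omega

theorem exists_generator_away {Q : HeightOnePrime (toricRing K Δ)} (ht : tElem K Δ ∉ Q.1.asIdeal) :
    ∃ q : toricRing K Δ, q ≠ 0 ∧ natOrd Q q = 1 ∧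
      ∀ Q' : HeightOnePrime (toricRing K Δ), tElem K Δ ∉ Q'.1.asIdeal → q ∈ Q'.1.asIdeal →
        Q' = Q := by
  obtain ⟨q, N, s, hq, hs, hsQ⟩ :=
    exists_prime_contraction_le ht (Ideal.ne_bot_of_height_eq_one Q.2)
  have hle := contraction_le ht hs hsQ
  have hqt : ¬ q ∣ X (Fin.last n) := fun h =>
    ht (hle (mem_contraction.2 (by rwa [coe_tElem])))
  have hs0 : s ≠ 0 := by
    rintro rfl
    exact mul_ne_zero (pow_ne_zero N (X_ne_zero _)) hq.ne_zero hs.symm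
  have key (Q' : HeightOnePrime (toricRing K Δ)) (ht' : tElem K Δ ∉ Q'.1.asIdeal)
      (h : s ∈ Q'.1.asIdeal) : contractionPrime Δ hq hqt = Q' := by
    refine Subtype.ext (PrimeSpectrum.ext ?_)
    have := isPrime_contraction (Δ := Δ) hq
    exact eq_of_le_heightOnePrime (Ideal.ne_bot_of_height_eq_one (height_contraction hq hqt))
      (contraction_le ht' hs h)
  refine ⟨s, hs0, ?_, fun Q' ht' h => ?_⟩
  · rw [← key Q ht hsQ]
    exact natOrd_contractionPrime_eq_one hq hqt hs
  · rw [← key Q ht hsQ, key Q' ht' h]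

/-- Stripped of their powers of `t`, `a` and `b` have the same multiplicity at every prime
polynomial. By unique factorization they differ by a unit, that is, by a nonzero constant. -/
theorem exists_eq_unit_mul {a b : toricRing K Δ} (ha : a ≠ 0) (hb : b ≠ 0)
    (h : ∀ Q : HeightOnePrime (toricRing K Δ), tElem K Δ ∉ Q.1.asIdeal →
      natOrd Q a = natOrd Q b) :
    ∃ (i j : ℕ) (u : toricRing K Δ), IsUnit u ∧
      tElem K Δ ^ i * a = u * (tElem K Δ ^ j * b) := by
  have hX : Prime (X (Fin.last n) : MvPolynomial (Fin (n + 1)) K) := X_prime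
  have hdecomp {c : toricRing K Δ} (hc : c ≠ 0) :
      ∃ (i : ℕ) (c' : MvPolynomial (Fin (n + 1)) K), c' ≠ 0 ∧ ¬ X (Fin.last n) ∣ c' ∧
        (c : MvPolynomial (Fin (n + 1)) K) = X (Fin.last n) ^ i * c' := by
    have hc' : (c : MvPolynomial (Fin (n + 1)) K) ≠ 0 := by simpa using hc
    obtain ⟨d, hd, hnd⟩ :=
      (FiniteMultiplicity.of_prime_left hX hc').exists_eq_pow_mul_and_not_dvd
    exact ⟨_, d, fun h => hnd (h ▸ dvd_zero _), hnd, hd⟩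
  obtain ⟨i, a', ha0, hta, hai⟩ := hdecomp ha
  obtain ⟨j, b', hb0, htb, hbj⟩ := hdecomp hb
  have hmult (p : MvPolynomial (Fin (n + 1)) K) (hp : Prime p) :
      emultiplicity p a' = emultiplicity p b' := by
    by_cases hpt : p ∣ X (Fin.last n)
    · have hass := hp.associated_of_dvd hX hpt
      rw [emultiplicity_eq_zero.2 fun h => hta (hass.symm.dvd.trans h),
        emultiplicity_eq_zero.2 fun h => htb (hass.symm.dvd.trans h)]
    · have h1 := natOrd_contractionPrime (Δ := Δ) hp hpt ha
      have h2 := natOrd_contractionPrime (Δ := Δ) hp hpt hb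
      have h3 (k : ℕ) : emultiplicity p (X (Fin.last n) ^ k) = 0 :=
        emultiplicity_eq_zero.2 fun h => hpt (hp.dvd_of_dvd_pow h)
      rw [hai, emultiplicity_mul hp, h3, zero_add] at h1
      rw [hbj, emultiplicity_mul hp, h3, zero_add] at h2
      rw [← h1, ← h2, h _ (tElem_notMem_contractionPrime hp hpt)]
  have hab : Associated a' b' := associated_of_dvd_dvd
    ((UniqueFactorizationMonoid.dvd_iff_emultiplicity_le ha0).2 fun p hp => (hmult p hp).le)
    ((UniqueFactorizationMonoid.dvd_iff_emultiplicity_le hb0).2 fun p hp => (hmult p hp).ge)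
  obtain ⟨u, hu⟩ := hab.symm
  obtain ⟨c, hc, hcu⟩ := isUnit_iff_eq_C_of_isReduced.1 u.isUnit
  -- The exponents are crossed: `a = t ^ i * a'` and `b = t ^ j * b'`.
  refine ⟨j, i, algebraMap K _ c, hc.map _, ?_⟩
  apply Subtype.ext
  push_cast
  rw [algebraMap_eq, ← hcu, hai, hbj, coe_tElem, ← hu]
  ring

end Localization

end ToricComplex

end

noncomputable section

namespace WeilDivisor

/-- A prime below `P` containing `t` contains `u * r` but not `u`, hence `r`. So `P` is minimal over
`t`, and its height is one. -/
theorem exists_natOrd_eq_one {R : Type*} [CommRing R] [IsDomain R] [IsNoetherianRing R] {t : R}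
    (ht : t ≠ 0) {P : Ideal R} [hP : P.IsPrime] (htP : t ∈ P)
    (h : ∀ r ∈ P, ∃ u ∉ P, t ∣ u * r) : ∃ P₀ : HeightOnePrime R, natOrd P₀ t = 1 := by
  have hmin : P ∈ (Ideal.span {t}).minimalPrimes := by
    refine ⟨⟨hP, by rwa [Ideal.span_singleton_le_iff_mem]⟩, fun Q ⟨hQ, htQ⟩ hQP r hr => ?_⟩
    obtain ⟨u, hu, hd⟩ := h r hr
    exact (hQ.mem_or_mem (Q.mem_of_dvd hd (htQ (Ideal.mem_span_singleton_self t)))).resolve_left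
      fun h => hu (hQP h)
  exact ⟨⟨⟨P, hP⟩, height_eq_one_of_mem_minimalPrimes ht hmin⟩, natOrd_eq_one htP h⟩

end WeilDivisor

namespace ToricComplex

open WeilDivisor MvPolynomial

variable {n : ℕ} {K : Type*} [Field K] {Δ : AbstractSimplicialComplex (Fin n)}

/-! ### Monomial primes of functionals nonnegative on the cone. -/

/-- The exponent vector of `x_F t`. -/
def faceExponent (F : Finset (Fin n)) : Fin (n + 1) →₀ ℕ :=
  (∑ i ∈ F, Finsupp.single i.castSucc 1) + Finsupp.single (Fin.last n) 1

/-- The point `p_F` of `ℝ^{n+1}`. -/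
def realPoint (F : Finset (Fin n)) : Fin (n + 1) → ℝ :=
  (∑ i ∈ F, Pi.single i.castSucc 1) + Pi.single (Fin.last n) 1

theorem realPoint_castSucc (F : Finset (Fin n)) (i : Fin n) :
    realPoint F i.castSucc = if i ∈ F then 1 else 0 := by
  simp [realPoint, Pi.single_apply]

theorem realPoint_last (F : Finset (Fin n)) : realPoint F (Fin.last n) = 1 := by
  simp [realPoint]

theorem faceMonomial_eq_monomial (F : Finset (Fin n)) :
    faceMonomial K F = monomial (faceExponent F) 1 := by
  rw [faceMonomial, faceExponent, ← mul_one (1 : K), ← monomial_mul, monomial_sum_one]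
  rfl

/-- The element `x_F t` of `R_Δ`. -/
def faceElem (K : Type*) [Field K] {F : Finset (Fin n)} (hF : F ∈ allFaces Δ) : toricRing K Δ :=
  ⟨faceMonomial K F, faceMonomial_mem hF⟩

theorem faceElem_ne_zero {F : Finset (Fin n)} (hF : F ∈ allFaces Δ) : faceElem K hF ≠ 0 := by
  intro h
  have := congrArg Subtype.val h
  change faceMonomial K F = 0 at this
  rw [faceMonomial_eq_monomial, monomial_eq_zero] at this
  exact one_ne_zero this

/-- The value of a linear functional at exponent vectors. -/
def weight (f : (Fin (n + 1) → ℝ) →ₗ[ℝ] ℝ) : (Fin (n + 1) →₀ ℕ) →+ ℝ where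
  toFun m := f fun j => (m j : ℝ)
  map_zero' := by
    rw [← map_zero f]
    congr 1
    ext
    simp
  map_add' a b := by
    rw [← map_add]
    congr 1
    ext
    simp

theorem weight_faceExponent (f : (Fin (n + 1) → ℝ) →ₗ[ℝ] ℝ) (F : Finset (Fin n)) :
    weight f (faceExponent F) = f (realPoint F) := by
  change f _ = _
  congr 1
  ext j
  simp [faceExponent, realPoint, Finsupp.single_apply, Pi.single_apply, eq_comm]

theorem mem_closure_of_mem_support {r : MvPolynomial (Fin (n + 1)) K} (hr : r ∈ toricRing K Δ)
    {m : Fin (n + 1) →₀ ℕ} (hm : m ∈ r.support) :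
    m ∈ AddSubmonoid.closure (faceExponent '' allFaces Δ) := by
  induction hr using Algebra.adjoin_induction generalizing m with
  | mem x hx =>
    obtain ⟨F, hF, rfl⟩ := hx
    rw [faceMonomial_eq_monomial] at hm
    rw [Finset.mem_singleton.1 (support_monomial_subset hm)]
    exact AddSubmonoid.subset_closure ⟨F, hF, rfl⟩
  | algebraMap c =>
    rw [Finset.mem_singleton.1 (support_monomial_subset hm)]
    exact zero_mem _
  | add x y _ _ hx hy =>
    classical
    rcases Finset.mem_union.1 (support_add hm) with h | h
    · exact hx h
    · exact hy h
  | mul x y _ _ hx hy =>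
    classical
    obtain ⟨a, ha, b, hb, rfl⟩ := Finset.mem_add.1 (support_mul x y hm)
    exact add_mem (hx ha) (hy hb)

theorem weight_nonneg {f : (Fin (n + 1) → ℝ) →ₗ[ℝ] ℝ}
    (hf : ∀ F ∈ allFaces Δ, 0 ≤ f (realPoint F)) {r : MvPolynomial (Fin (n + 1)) K}
    (hr : r ∈ toricRing K Δ) {m : Fin (n + 1) →₀ ℕ} (hm : m ∈ r.support) : 0 ≤ weight f m := by
  have hmem := mem_closure_of_mem_support hr hm
  clear hm
  induction hmem using AddSubmonoid.closure_induction with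
  | mem x hx =>
    obtain ⟨F, hF, rfl⟩ := hx
    rw [weight_faceExponent]
    exact hf F hF
  | zero => rw [map_zero]
  | add x y _ _ hx hy => rw [map_add]; exact add_nonneg hx hy

/-- The sum of the terms of `p` of weight zero. -/
def zeroPart (f : (Fin (n + 1) → ℝ) →ₗ[ℝ] ℝ) (p : MvPolynomial (Fin (n + 1)) K) :
    MvPolynomial (Fin (n + 1)) K :=
  open Classical in ∑ m ∈ p.support with weight f m = 0, monomial m (coeff m p)

theorem coeff_zeroPart_of_eq {f : (Fin (n + 1) → ℝ) →ₗ[ℝ] ℝ} (p : MvPolynomial (Fin (n + 1)) K)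
    {m : Fin (n + 1) →₀ ℕ} (hm : weight f m = 0) : coeff m (zeroPart f p) = coeff m p := by
  classical
  rw [zeroPart, coeff_sum]
  simp only [coeff_monomial]
  rw [Finset.sum_ite_eq']
  simp only [Finset.mem_filter, hm, and_true, mem_support_iff, ite_not, ite_eq_right_iff]
  exact fun h => h.symm

theorem coeff_zeroPart_of_ne {f : (Fin (n + 1) → ℝ) →ₗ[ℝ] ℝ} (p : MvPolynomial (Fin (n + 1)) K)
    {m : Fin (n + 1) →₀ ℕ} (hm : weight f m ≠ 0) : coeff m (zeroPart f p) = 0 := by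
  classical
  rw [zeroPart, coeff_sum]
  simp only [coeff_monomial]
  rw [Finset.sum_ite_eq', if_neg]
  simp [hm]

theorem zeroPart_eq_zero_iff {f : (Fin (n + 1) → ℝ) →ₗ[ℝ] ℝ} {p : MvPolynomial (Fin (n + 1)) K} :
    zeroPart f p = 0 ↔ ∀ m, weight f m = 0 → coeff m p = 0 := by
  constructor
  · intro h m hm
    rw [← coeff_zeroPart_of_eq p hm, h, coeff_zero]
  · intro h
    ext m
    rw [coeff_zero]
    by_cases hm : weight f m = 0
    · rw [coeff_zeroPart_of_eq p hm, h m hm]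
    · exact coeff_zeroPart_of_ne p hm

theorem zeroPart_add (f : (Fin (n + 1) → ℝ) →ₗ[ℝ] ℝ) (p q : MvPolynomial (Fin (n + 1)) K) :
    zeroPart f (p + q) = zeroPart f p + zeroPart f q := by
  ext m
  rw [coeff_add]
  by_cases hm : weight f m = 0
  · rw [coeff_zeroPart_of_eq _ hm, coeff_zeroPart_of_eq _ hm, coeff_zeroPart_of_eq _ hm, coeff_add]
  · rw [coeff_zeroPart_of_ne _ hm, coeff_zeroPart_of_ne _ hm, coeff_zeroPart_of_ne _ hm, add_zero]

/-- Exponents in `R_Δ` have nonnegative weight, so a weight zero term of a product arises only from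
two weight zero terms. The weight ideal is thus the kernel of a multiplicative map into a domain,
hence prime. -/
theorem zeroPart_mul {f : (Fin (n + 1) → ℝ) →ₗ[ℝ] ℝ}
    (hf : ∀ F ∈ allFaces Δ, 0 ≤ f (realPoint F)) {p q : MvPolynomial (Fin (n + 1)) K}
    (hp : p ∈ toricRing K Δ) (hq : q ∈ toricRing K Δ) :
    zeroPart f (p * q) = zeroPart f p * zeroPart f q := by
  classical
  ext m
  rw [coeff_mul]
  by_cases hm : weight f m = 0
  · rw [coeff_zeroPart_of_eq _ hm, coeff_mul]
    refine Finset.sum_congr rfl fun ⟨a, b⟩ hab => ?_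
    have hsum : weight f a + weight f b = 0 := by
      rw [← map_add, Finset.HasAntidiagonal.mem_antidiagonal.1 hab, hm]
    by_cases ha : weight f a = 0
    · have hb : weight f b = 0 := by linarith
      rw [coeff_zeroPart_of_eq _ ha, coeff_zeroPart_of_eq _ hb]
    · rw [coeff_zeroPart_of_ne _ ha, zero_mul]
      by_contra h
      have h1 := weight_nonneg hf hp (mem_support_iff.2 (left_ne_zero_of_mul h))
      have h2 := weight_nonneg hf hq (mem_support_iff.2 (right_ne_zero_of_mul h))
      exact ha (by linarith)
  · rw [coeff_zeroPart_of_ne _ hm, Finset.sum_eq_zero]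
    rintro ⟨a, b⟩ hab
    have hsum : weight f a + weight f b ≠ 0 := by
      rwa [← map_add, Finset.HasAntidiagonal.mem_antidiagonal.1 hab]
    by_cases ha : weight f a = 0
    · rw [ha, zero_add] at hsum
      rw [coeff_zeroPart_of_ne _ hsum, mul_zero]
    · rw [coeff_zeroPart_of_ne _ ha, zero_mul]

/-- The monomial prime ideal of `R_Δ` consisting of the elements all of whose terms have positive
weight, for a functional that is nonnegative on the cone. -/
def weightIdeal (f : (Fin (n + 1) → ℝ) →ₗ[ℝ] ℝ) (hf : ∀ F ∈ allFaces Δ, 0 ≤ f (realPoint F)) :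
    Ideal (toricRing K Δ) where
  carrier := {r | zeroPart f (r : MvPolynomial (Fin (n + 1)) K) = 0}
  zero_mem' := zeroPart_eq_zero_iff.2 fun m _ => coeff_zero m
  add_mem' {r s} hr hs := by
    rw [Set.mem_ofPred_eq] at hr hs
    rw [Set.mem_ofPred_eq, AddMemClass.coe_add, zeroPart_add, hr, hs, add_zero]
  smul_mem' r s hs := by
    rw [Set.mem_ofPred_eq] at hs
    rw [Set.mem_ofPred_eq, smul_eq_mul, MulMemClass.coe_mul, zeroPart_mul hf r.2 s.2, hs, mul_zero]

section WeightIdeal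

variable {f : (Fin (n + 1) → ℝ) →ₗ[ℝ] ℝ} {hf : ∀ F ∈ allFaces Δ, 0 ≤ f (realPoint F)}

theorem mem_weightIdeal {r : toricRing K Δ} :
    r ∈ weightIdeal f hf ↔ zeroPart f (r : MvPolynomial (Fin (n + 1)) K) = 0 := Iff.rfl

instance isPrime_weightIdeal : (weightIdeal f hf : Ideal (toricRing K Δ)).IsPrime where
  ne_top' := by
    rw [Ideal.ne_top_iff_one, mem_weightIdeal, zeroPart_eq_zero_iff]
    intro h
    have := h 0 (map_zero _)
    rw [OneMemClass.coe_one, coeff_zero_one] at this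
    exact one_ne_zero this
  mem_or_mem' {r s} h := by
    rw [mem_weightIdeal, MulMemClass.coe_mul, zeroPart_mul hf r.2 s.2] at h
    exact mul_eq_zero.1 h

theorem faceElem_mem_weightIdeal {F : Finset (Fin n)} (hF : F ∈ allFaces Δ) :
    faceElem K hF ∈ weightIdeal f hf ↔ f (realPoint F) ≠ 0 := by
  classical
  rw [mem_weightIdeal, zeroPart_eq_zero_iff, ← weight_faceExponent]
  change (∀ m, weight f m = 0 → coeff m (faceMonomial K F) = 0) ↔ _
  rw [faceMonomial_eq_monomial]
  simp only [coeff_monomial, ite_eq_right_iff, one_ne_zero, imp_false]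
  exact ⟨fun h h0 => h _ h0 rfl, fun h m hm he => h (he ▸ hm)⟩

/-- A monomial of `R_Δ` is a product of generators; if its weight is nonzero, so is that of some
factor. Hence the generators `x_F t` of nonzero weight generate the ideal. -/
theorem weightIdeal_le {I : Ideal (toricRing K Δ)}
    (hI : ∀ F (hF : F ∈ allFaces Δ), f (realPoint F) ≠ 0 → faceElem K hF ∈ I) :
    weightIdeal f hf ≤ I := by
  have key (m : Fin (n + 1) →₀ ℕ) (hm : m ∈ AddSubmonoid.closure (faceExponent '' allFaces Δ)) :
      ∃ s : toricRing K Δ, (s : MvPolynomial (Fin (n + 1)) K) = monomial m 1 ∧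
        (weight f m ≠ 0 → s ∈ I) := by
    induction hm using AddSubmonoid.closure_induction with
    | mem x hx =>
      obtain ⟨F, hF, rfl⟩ := hx
      rw [weight_faceExponent]
      exact ⟨faceElem K hF, faceMonomial_eq_monomial F, hI F hF⟩
    | zero => exact ⟨1, rfl, fun h => absurd (map_zero _) h⟩
    | add x y _ _ hx hy =>
      obtain ⟨s, hs, hsI⟩ := hx
      obtain ⟨r, hr, hrI⟩ := hy
      refine ⟨s * r, by rw [MulMemClass.coe_mul, hs, hr, monomial_mul, mul_one], fun h => ?_⟩
      by_cases hx0 : weight f x = 0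
      · rw [map_add, hx0, zero_add] at h
        exact I.mul_mem_left _ (hrI h)
      · exact I.mul_mem_right _ (hsI hx0)
  intro r hr
  -- Individual terms are handled in the image of `I`, a `K`-subspace of the polynomial ring.
  have hmem : (r : MvPolynomial (Fin (n + 1)) K) ∈
      (I.restrictScalars K).map (toricRing K Δ).val.toLinearMap := by
    rw [as_sum (r : MvPolynomial (Fin (n + 1)) K)]
    refine Submodule.sum_mem _ fun m hm => ?_
    obtain ⟨s, hs, hsI⟩ := key m (mem_closure_of_mem_support r.2 hm)
    refine ⟨coeff m (r : MvPolynomial (Fin (n + 1)) K) • s, ?_, ?_⟩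
    · refine Submodule.smul_mem (I.restrictScalars K) _ (hsI fun h0 => ?_)
      exact mem_support_iff.1 hm (zeroPart_eq_zero_iff.1 (mem_weightIdeal.1 hr) m h0)
    · change coeff m (r : MvPolynomial (Fin (n + 1)) K) • (s : MvPolynomial (Fin (n + 1)) K) = _
      rw [hs, smul_monomial, smul_eq_mul, mul_one]
  obtain ⟨s, hs, he⟩ := hmem
  rwa [← Subtype.ext he]

end WeightIdeal

/-! ### A prime at which `t` has order one. -/

section OrderOne

/-- Maximal vertex sets meeting each face at most once: every other vertex is joined to them. -/
theorem exists_maximal_transversal (Δ : AbstractSimplicialComplex (Fin n)) :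
    ∃ A : Finset (Fin n), (∀ F ∈ allFaces Δ, (F ∩ A).card ≤ 1) ∧
      ∀ i ∉ A, ∃ j ∈ A, ({i, j} : Finset (Fin n)) ∈ allFaces Δ := by
  obtain ⟨A, hA⟩ := (Set.toFinite
    {A : Finset (Fin n) | ∀ F ∈ allFaces Δ, (F ∩ A).card ≤ 1}).exists_maximal ⟨∅, by simp⟩
  refine ⟨A, hA.prop, fun i hi => ?_⟩
  have hnot : ¬ ∀ F ∈ allFaces Δ, (F ∩ insert i A).card ≤ 1 := fun h =>
    hi (hA.le_of_ge (y := insert i A) h (Finset.subset_insert i A) (Finset.mem_insert_self i A))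
  push Not at hnot
  obtain ⟨F, hF, hcard⟩ := hnot
  have hiF : i ∈ F := by
    by_contra h
    rw [Finset.inter_insert_of_notMem h] at hcard
    exact absurd (hA.prop F hF) (by omega)
  rw [Finset.inter_insert_of_mem hiF, Finset.card_insert_of_notMem (by simp [hi])] at hcard
  obtain ⟨j, hj⟩ := Finset.card_pos.1 (show 0 < (F ∩ A).card by omega)
  rw [Finset.mem_inter] at hj
  refine ⟨j, hj.2, mem_allFaces_of_subset hF ?_⟩
  intro k hk
  rcases Finset.mem_insert.1 hk with rfl | hk
  · exact hiF
  · rw [Finset.mem_singleton.1 hk]; exact hj.1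

/-- The functional `h - ∑_{i ∈ A} x_i`. -/
def transversalFunctional (A : Finset (Fin n)) : (Fin (n + 1) → ℝ) →ₗ[ℝ] ℝ :=
  LinearMap.proj (Fin.last n) - ∑ i ∈ A, LinearMap.proj i.castSucc

theorem transversalFunctional_realPoint (A F : Finset (Fin n)) :
    transversalFunctional A (realPoint F) = 1 - (F ∩ A).card := by
  simp [transversalFunctional, realPoint_castSucc, realPoint_last, Finset.inter_comm]

theorem exists_natOrd_tElem_eq_one (K : Type*) [Field K] (Δ : AbstractSimplicialComplex (Fin n)) :
    ∃ P : HeightOnePrime (toricRing K Δ), natOrd P (tElem K Δ) = 1 := by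
  obtain ⟨A, hA, hj⟩ := exists_maximal_transversal Δ
  have hf : ∀ F ∈ allFaces Δ, 0 ≤ transversalFunctional A (realPoint F) := by
    intro F hF
    rw [transversalFunctional_realPoint]
    have : ((F ∩ A).card : ℝ) ≤ 1 := by exact_mod_cast hA F hF
    linarith
  let P : Ideal (toricRing K Δ) := weightIdeal (transversalFunctional A) hf
  have hP : P.IsPrime := isPrime_weightIdeal
  -- The elements divisible by `t` locally at `P` form an ideal, so it suffices to test the
  -- generators of `P`.
  let J : Ideal (toricRing K Δ) :=
    { carrier := {r | ∃ u ∉ P, tElem K Δ ∣ u * r}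
      zero_mem' := ⟨1, P.ne_top_iff_one.1 hP.ne_top, by simp⟩
      add_mem' := by
        rintro r s ⟨u, hu, hr⟩ ⟨v, hv, hs⟩
        refine ⟨u * v, fun h => (hP.mem_or_mem h).elim hu hv, ?_⟩
        rw [mul_add]
        refine dvd_add ?_ ?_
        · rw [mul_right_comm]; exact hr.mul_right v
        · rw [mul_assoc]; exact hs.mul_left u
      smul_mem' := by
        rintro c r ⟨u, hu, hr⟩
        refine ⟨u, hu, ?_⟩
        rw [smul_eq_mul, mul_left_comm]
        exact hr.mul_left c }
  refine exists_natOrd_eq_one (P := P) tElem_ne_zero ?_ ?_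
  · refine (faceElem_mem_weightIdeal (K := K) (empty_mem_allFaces (Δ := Δ))).2 ?_
    simp [transversalFunctional_realPoint]
  · change P ≤ J
    refine weightIdeal_le fun G hG hG0 => ?_
    have hGA : G ∩ A = ∅ := by
      rw [transversalFunctional_realPoint] at hG0
      rw [← Finset.card_eq_zero]
      have h1 := hA G hG
      have h2 : (G ∩ A).card ≠ 1 := fun h => hG0 (by rw [h]; simp)
      omega
    have hnot (i : Fin n) (hi : i ∈ G) : i ∉ A := fun h =>
      Finset.notMem_empty i (hGA ▸ Finset.mem_inter.2 ⟨hi, h⟩)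
    choose j hjA hjF using hj
    -- Each `i ∈ G` is joined to some `j(i) ∈ A`, and `x_G t * ∏ (x_{j(i)} t) = t * ∏ (x_i x_{j(i)}
    -- t)`. The factors `x_{j(i)} t` have weight zero, so their product is outside `P`.
    refine ⟨∏ i ∈ G.attach, faceElem K (singleton_mem_allFaces (j i (hnot i i.2))), fun h => ?_,
      ∏ i ∈ G.attach, faceElem K (hjF i (hnot i i.2)), ?_⟩
    · obtain ⟨i, -, hi⟩ := hP.prod_mem_iff.1 h
      refine (faceElem_mem_weightIdeal _).1 hi ?_
      rw [transversalFunctional_realPoint, Finset.singleton_inter_of_mem (hjA _ _)]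
      simp
    · apply Subtype.ext
      push_cast
      change (∏ i ∈ G.attach, faceMonomial K {j i (hnot i i.2)}) * faceMonomial K G =
        tElem K Δ * ∏ i ∈ G.attach, faceMonomial K {i.1, j i (hnot i i.2)}
      have hne (i : G) : i.1 ≠ j i (hnot i i.2) := fun h => hnot i i.2 (h ▸ hjA _ _)
      rw [coe_tElem]
      simp only [faceMonomial, Finset.prod_singleton, Finset.prod_pair (hne _)]
      rw [← Finset.prod_attach G]
      simp only [Finset.prod_mul_distrib]
      ring

end OrderOne

end ToricComplex

end

noncomputable section

namespace ToricComplex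

open WeilDivisor MvPolynomial

variable {n : ℕ} {K : Type*} [Field K] {Δ : AbstractSimplicialComplex (Fin n)}

/-! ### The cone and its supporting functionals. -/

section Cone

theorem realPoint_empty : realPoint (∅ : Finset (Fin n)) = Pi.single (Fin.last n) 1 := by
  simp [realPoint]

theorem coe_facePoint (F : Finset (Fin n)) :
    (fun j => (facePoint F j : ℝ)) = realPoint F := by
  ext j
  simp [facePoint, realPoint, Pi.single_apply]

theorem semigroupCone_eq_hull (Δ : AbstractSimplicialComplex (Fin n)) :
    semigroupCone Δ = PointedCone.hull ℝ (realPoint '' allFaces Δ) := by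
  apply le_antisymm
  · refine Submodule.span_le.2 ?_
    rintro _ ⟨v, hv, rfl⟩
    induction hv using AddSubmonoid.closure_induction with
    | mem x hx =>
      obtain ⟨F, hF, rfl⟩ := hx
      exact Submodule.subset_span ⟨F, hF, (coe_facePoint F).symm⟩
    | zero =>
      have h : (fun j => (((0 : Fin (n + 1) → ℤ) j : ℤ) : ℝ)) = 0 := by ext; simp
      change (fun j => _) ∈ _
      rw [h]
      exact zero_mem (PointedCone.hull ℝ (realPoint '' allFaces Δ))
    | add x y _ _ hx hy =>
      have h : (fun j => (((x + y) j : ℤ) : ℝ)) = (fun j => (x j : ℝ)) + fun j => (y j : ℝ) := by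
        ext; simp
      change (fun j => _) ∈ _
      rw [h]
      exact add_mem hx hy
  · refine Submodule.span_mono ?_
    rintro _ ⟨F, hF, rfl⟩
    exact ⟨facePoint F, AddSubmonoid.subset_closure ⟨F, hF, rfl⟩, coe_facePoint F⟩

theorem realPoint_mem_semigroupCone {F : Finset (Fin n)} (hF : F ∈ allFaces Δ) :
    realPoint F ∈ semigroupCone Δ := by
  rw [semigroupCone_eq_hull]
  exact Submodule.subset_span ⟨F, hF, rfl⟩

theorem span_realPoint (Δ : AbstractSimplicialComplex (Fin n)) :
    Submodule.span ℝ (realPoint '' allFaces Δ) = ⊤ := by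
  have hlast : (Pi.single (Fin.last n) 1 : Fin (n + 1) → ℝ) ∈
      Submodule.span ℝ (realPoint '' allFaces Δ) :=
    Submodule.subset_span ⟨∅, empty_mem_allFaces, realPoint_empty⟩
  rw [← top_le_iff, ← (Pi.basisFun ℝ (Fin (n + 1))).span_eq, Submodule.span_le]
  rintro _ ⟨j, rfl⟩
  rw [Pi.basisFun_apply]
  induction j using Fin.lastCases with
  | last => exact hlast
  | cast i =>
    have hi : realPoint {i} ∈ Submodule.span ℝ (realPoint '' allFaces Δ) :=
      Submodule.subset_span ⟨{i}, singleton_mem_allFaces i, rfl⟩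
    have h := Submodule.sub_mem _ hi hlast
    rwa [realPoint, Finset.sum_singleton, add_sub_cancel_right] at h

theorem span_semigroupCone (Δ : AbstractSimplicialComplex (Fin n)) :
    Submodule.span ℝ (semigroupCone Δ : Set (Fin (n + 1) → ℝ)) = ⊤ := by
  rw [← top_le_iff, ← span_realPoint Δ]
  refine Submodule.span_mono ?_
  rintro _ ⟨F, hF, rfl⟩
  exact realPoint_mem_semigroupCone hF

/-- A sum of nonnegative values vanishes only if every summand does, so a face is spanned as a cone
by the generators it contains. -/
theorem nonneg_and_mem_hull {f : (Fin (n + 1) → ℝ) →ₗ[ℝ] ℝ}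
    (hf : ∀ F ∈ allFaces Δ, 0 ≤ f (realPoint F)) {x : Fin (n + 1) → ℝ}
    (hx : x ∈ semigroupCone Δ) :
    0 ≤ f x ∧ (f x = 0 →
      x ∈ PointedCone.hull ℝ (realPoint '' {F ∈ allFaces Δ | f (realPoint F) = 0})) := by
  rw [semigroupCone_eq_hull] at hx
  induction hx using Submodule.span_induction with
  | mem x hx =>
    obtain ⟨F, hF, rfl⟩ := hx
    exact ⟨hf F hF, fun h => Submodule.subset_span ⟨F, ⟨hF, h⟩, rfl⟩⟩
  | zero => exact ⟨(map_zero f).ge, fun _ => zero_mem _⟩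
  | add x y _ _ hx hy =>
    rw [map_add]
    refine ⟨add_nonneg hx.1 hy.1, fun h => ?_⟩
    have h1 := hx.1
    have h2 := hy.1
    exact add_mem (hx.2 (by linarith)) (hy.2 (by linarith))
  | smul c x _ hx =>
    have hc : f (c • x) = (c : ℝ) * f x := map_smul f (c : ℝ) x
    rw [hc]
    refine ⟨mul_nonneg c.2 hx.1, fun h => ?_⟩
    rcases mul_eq_zero.1 h with h | h
    · rw [show c = 0 from Subtype.ext h, zero_smul]
      exact zero_mem _
    · exact Submodule.smul_mem _ c (hx.2 h)

theorem finrank_ker {f : (Fin (n + 1) → ℝ) →ₗ[ℝ] ℝ} (hf : f ≠ 0) :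
    Module.finrank ℝ (LinearMap.ker f) = n := by
  have h1 := f.finrank_range_add_finrank_ker
  rw [LinearMap.range_eq_top.2 (LinearMap.surjective hf), finrank_top, Module.finrank_self,
    Module.finrank_fin_fun] at h1
  omega

/-- A functional which is nonnegative on the cone and positive at `e_{n+1}` can be rotated until
it vanishes on a facet, keeping its zeros. -/
theorem exists_facet_functional {f : (Fin (n + 1) → ℝ) →ₗ[ℝ] ℝ}
    (hf : ∀ F ∈ allFaces Δ, 0 ≤ f (realPoint F)) (hf0 : 0 < f (realPoint ∅)) :
    ∃ g : (Fin (n + 1) → ℝ) →ₗ[ℝ] ℝ, (∀ F ∈ allFaces Δ, 0 ≤ g (realPoint F)) ∧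
      0 < g (realPoint ∅) ∧ (∀ F ∈ allFaces Δ, f (realPoint F) = 0 → g (realPoint F) = 0) ∧
      Submodule.span ℝ (insert (realPoint ∅)
        (realPoint '' {F ∈ allFaces Δ | g (realPoint F) = 0})) = ⊤ := by
  -- The induction is on the number of faces at which `f` does not vanish.
  induction hN : {F ∈ allFaces Δ | f (realPoint F) ≠ 0}.ncard using Nat.strong_induction_on
    generalizing f with
  | _ N ih =>
    by_cases hspan : Submodule.span ℝ (insert (realPoint ∅)
        (realPoint '' {F ∈ allFaces Δ | f (realPoint F) = 0})) = ⊤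
    · exact ⟨f, hf, hf0, fun _ _ h => h, hspan⟩
    have hg : ∃ g : (Fin (n + 1) → ℝ) →ₗ[ℝ] ℝ, g (realPoint ∅) = 0 ∧
        (∀ F ∈ allFaces Δ, f (realPoint F) = 0 → g (realPoint F) = 0) ∧
        ∃ F ∈ allFaces Δ, g (realPoint F) < 0 := by
      obtain ⟨g, hg0, hg⟩ := Submodule.exists_le_ker_of_lt_top _ (lt_top_iff_ne_top.2 hspan)
      have hg1 : g (realPoint ∅) = 0 := hg (Submodule.subset_span (Set.mem_insert _ _))
      have hg2 : ∀ F ∈ allFaces Δ, f (realPoint F) = 0 → g (realPoint F) = 0 := fun F hF h =>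
        hg (Submodule.subset_span (Set.mem_insert_of_mem _ ⟨F, ⟨hF, h⟩, rfl⟩))
      have hex : ∃ F ∈ allFaces Δ, g (realPoint F) ≠ 0 := by
        by_contra! h
        refine hg0 (LinearMap.ext_on (span_realPoint Δ) ?_)
        rintro _ ⟨F, hF, rfl⟩
        exact h F hF
      obtain ⟨F, hF, hne⟩ := hex
      rcases lt_or_gt_of_ne hne with h | h
      · exact ⟨g, hg1, hg2, F, hF, h⟩
      · refine ⟨-g, ?_, fun G hG h0 => ?_, F, hF, ?_⟩
        · rw [LinearMap.neg_apply, hg1, neg_zero]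
        · rw [LinearMap.neg_apply, hg2 G hG h0, neg_zero]
        · rw [LinearMap.neg_apply]; linarith
    obtain ⟨g, hg1, hg2, F₁, hF₁, hneg⟩ := hg
    obtain ⟨F₀, ⟨hF₀, hF₀neg⟩, hmin⟩ := Set.exists_min_image
      {F ∈ allFaces Δ | g (realPoint F) < 0} (fun F => f (realPoint F) / -g (realPoint F))
      (Set.toFinite _) ⟨F₁, hF₁, hneg⟩
    -- The least ratio is the largest `c` keeping `f + c • g` nonnegative; it creates a new zero at
    -- `F₀`. As `g` kills `p_∅` and the old zeros, positivity at `e_{n+1}` and those zeros survive.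
    set c := f (realPoint F₀) / -g (realPoint F₀) with hc
    have hc0 : 0 ≤ c := div_nonneg (hf F₀ hF₀) (by linarith)
    have happ (x : Fin (n + 1) → ℝ) : (f + c • g) x = f x + c * g x := by simp
    have hF₀zero : (f + c • g) (realPoint F₀) = 0 := by
      have hne := hF₀neg.ne
      rw [happ, hc]
      field_simp
      ring
    have hkeep : ∀ F ∈ allFaces Δ, f (realPoint F) = 0 → (f + c • g) (realPoint F) = 0 := by
      intro F hF h
      rw [happ, h, hg2 F hF h, mul_zero, add_zero]
    have hlt : {F ∈ allFaces Δ | (f + c • g) (realPoint F) ≠ 0}.ncard < N := by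
      rw [← hN]
      refine Set.ncard_lt_ncard ⟨fun F hF => ⟨hF.1, fun h => hF.2 (hkeep F hF.1 h)⟩, fun h => ?_⟩
        (Set.toFinite _)
      exact (h ⟨hF₀, fun h0 => hF₀neg.ne (hg2 F₀ hF₀ h0)⟩).2 hF₀zero
    have hnonneg : ∀ F ∈ allFaces Δ, 0 ≤ (f + c • g) (realPoint F) := by
      intro F hF
      rw [happ]
      rcases le_or_gt 0 (g (realPoint F)) with h | h
      · exact add_nonneg (hf F hF) (mul_nonneg hc0 h)
      · have := hmin F ⟨hF, h⟩
        rw [le_div_iff₀ (by linarith)] at this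
        linarith
    obtain ⟨g', h1, h2, h3, h4⟩ := ih _ hlt hnonneg (by rwa [happ, hg1, mul_zero, add_zero]) rfl
    exact ⟨g', h1, h2, fun F hF h => h3 F hF (hkeep F hF h), h4⟩

end Cone

/-! ### Orders of monomials as linear functionals. -/

section Valuation

theorem natOrd_prod {R ι : Type*} [CommRing R] [IsDomain R] [IsNoetherianRing R]
    (P : HeightOnePrime R) (s : Finset ι) {a : ι → R} (ha : ∀ i, a i ≠ 0) :
    natOrd P (∏ i ∈ s, a i) = ∑ i ∈ s, natOrd P (a i) := by
  classical
  induction s using Finset.induction_on with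
  | empty => simp [natOrd_one]
  | insert i s hi ih =>
    rw [Finset.prod_insert hi, Finset.sum_insert hi,
      natOrd_mul P (ha i) (Finset.prod_ne_zero_iff.2 fun j _ => ha j), ih]

/-- The order at `P` of the monomials of `R_Δ` is given by a linear functional. -/
theorem exists_functional_natOrd (P : HeightOnePrime (toricRing K Δ)) :
    ∃ f : (Fin (n + 1) → ℝ) →ₗ[ℝ] ℝ, ∀ F (hF : F ∈ allFaces Δ),
      f (realPoint F) = natOrd P (faceElem K hF) := by
  let v (i : Fin n) : ℝ := natOrd P (faceElem K (singleton_mem_allFaces (Δ := Δ) i))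
  let b : ℝ := natOrd P (tElem K Δ)
  -- The coefficient `v i - b` is the order of `x_i = (x_i t)/t`.
  refine ⟨∑ i, (v i - b) • LinearMap.proj i.castSucc + b • LinearMap.proj (Fin.last n),
    fun F hF => ?_⟩
  have hmul : faceElem K hF * tElem K Δ ^ F.card =
      tElem K Δ * ∏ i ∈ F, faceElem K (singleton_mem_allFaces (Δ := Δ) i) := by
    apply Subtype.ext
    push_cast
    change faceMonomial K F * _ = _ * ∏ i ∈ F, faceMonomial K {i}
    rw [coe_tElem]
    simp only [faceMonomial, Finset.prod_singleton, Finset.prod_mul_distrib, Finset.prod_const]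
    ring
  have ht0 : tElem K Δ ≠ 0 := tElem_ne_zero
  have hne (i : Fin n) : faceElem K (singleton_mem_allFaces (Δ := Δ) i) ≠ 0 := faceElem_ne_zero _
  have hord := congrArg (natOrd P) hmul
  rw [natOrd_mul P (faceElem_ne_zero hF) (pow_ne_zero _ ht0), natOrd_pow P ht0,
    natOrd_mul P ht0 (Finset.prod_ne_zero_iff.2 fun i _ => hne i), natOrd_prod P F hne] at hord
  have hord' : (natOrd P (faceElem K hF) : ℝ) + F.card * b = b + ∑ i ∈ F, v i := by
    simp only [v, b]
    exact_mod_cast hord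
  simp only [LinearMap.add_apply, LinearMap.sum_apply, LinearMap.smul_apply, LinearMap.proj_apply,
    realPoint_castSucc, realPoint_last, smul_eq_mul, mul_one, mul_ite, mul_zero, Finset.sum_ite_mem, Finset.univ_inter,
    Finset.sum_sub_distrib, Finset.sum_const, nsmul_eq_mul]
  linarith

end Valuation

/-! ### Facets avoiding `e_{n+1}` and minimal primes of `(t)`. -/

section Facets

/-- The ideal of `R_Δ` generated by the monomials `x_G t` with `p_G ∉ F`. -/
def facetIdeal (K : Type*) [Field K] (Δ : AbstractSimplicialComplex (Fin n))
    (F : Set (Fin (n + 1) → ℝ)) : Ideal (toricRing K Δ) :=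
  Ideal.span {r | ∃ (G : Finset (Fin n)) (hG : G ∈ allFaces Δ), realPoint G ∉ F ∧
    r = faceElem K hG}

/-- The face of the cone cut out by `f`. -/
def coneFace (Δ : AbstractSimplicialComplex (Fin n)) (f : (Fin (n + 1) → ℝ) →ₗ[ℝ] ℝ) :
    Set (Fin (n + 1) → ℝ) :=
  {x | x ∈ semigroupCone Δ ∧ f x = 0}

theorem realPoint_mem_coneFace {f : (Fin (n + 1) → ℝ) →ₗ[ℝ] ℝ} {G : Finset (Fin n)}
    (hG : G ∈ allFaces Δ) : realPoint G ∈ coneFace Δ f ↔ f (realPoint G) = 0 :=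
  ⟨fun h => h.2, fun h => ⟨realPoint_mem_semigroupCone hG, h⟩⟩

/-- The monomial prime depends only on the face cut out, not on the functional chosen to define it.
-/
theorem facetIdeal_coneFace {f : (Fin (n + 1) → ℝ) →ₗ[ℝ] ℝ}
    (hf : ∀ F ∈ allFaces Δ, 0 ≤ f (realPoint F)) :
    facetIdeal K Δ (coneFace Δ f) = weightIdeal f hf := by
  apply le_antisymm
  · refine Ideal.span_le.2 ?_
    rintro _ ⟨G, hG, hGF, rfl⟩
    exact (faceElem_mem_weightIdeal hG).2 fun h => hGF ((realPoint_mem_coneFace hG).2 h)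
  · exact weightIdeal_le fun G hG h =>
      Ideal.subset_span ⟨G, hG, fun h' => h ((realPoint_mem_coneFace hG).1 h'), rfl⟩

/-- A generator on the face of `f` lies outside the prime of `f`, hence outside that of `g`, so `g`
vanishes on it; such generators span the face. -/
theorem coneFace_subset {f g : (Fin (n + 1) → ℝ) →ₗ[ℝ] ℝ}
    (hf : ∀ F ∈ allFaces Δ, 0 ≤ f (realPoint F)) (hg : ∀ F ∈ allFaces Δ, 0 ≤ g (realPoint F))
    (h : facetIdeal K Δ (coneFace Δ g) ≤ facetIdeal K Δ (coneFace Δ f)) :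
    coneFace Δ f ⊆ coneFace Δ g := by
  rw [facetIdeal_coneFace hf, facetIdeal_coneFace hg] at h
  rintro x ⟨hxC, hx⟩
  refine ⟨hxC, ?_⟩
  have hmem := (nonneg_and_mem_hull hf hxC).2 hx
  have hle : PointedCone.hull ℝ (realPoint '' {F ∈ allFaces Δ | f (realPoint F) = 0}) ≤
      PointedCone.ofSubmodule (LinearMap.ker g) := by
    refine Submodule.span_le.2 ?_
    rintro _ ⟨G, ⟨hG, hfG⟩, rfl⟩
    by_contra hgG
    exact (faceElem_mem_weightIdeal (K := K) (hf := hf) hG).1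
      (h ((faceElem_mem_weightIdeal hG).2 hgG)) hfG
  exact hle hmem

theorem exists_functional_of_mem_facetsAvoidingLast {F : Set (Fin (n + 1) → ℝ)}
    (hF : F ∈ facetsAvoidingLast Δ) :
    ∃ f : (Fin (n + 1) → ℝ) →ₗ[ℝ] ℝ, (∀ F ∈ allFaces Δ, 0 ≤ f (realPoint F)) ∧
      F = coneFace Δ f ∧ f (realPoint ∅) ≠ 0 ∧ Submodule.span ℝ F = LinearMap.ker f := by
  obtain ⟨⟨⟨f, hf0, hf, rfl⟩, hdim⟩, hlast⟩ := hF
  refine ⟨f, fun G hG => hf _ (realPoint_mem_semigroupCone hG), rfl, fun h => hlast ?_, ?_⟩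
  · rw [← realPoint_empty]
    exact ⟨realPoint_mem_semigroupCone empty_mem_allFaces, h⟩
  · refine Submodule.eq_of_le_of_finrank_eq (Submodule.span_le.2 fun x hx => hx.2) ?_
    rw [span_semigroupCone, finrank_top, Module.finrank_fin_fun] at hdim
    rw [finrank_ker hf0]
    omega

theorem coneFace_mem_facetsAvoidingLast {f : (Fin (n + 1) → ℝ) →ₗ[ℝ] ℝ}
    (hf : ∀ F ∈ allFaces Δ, 0 ≤ f (realPoint F)) (hf0 : 0 < f (realPoint ∅))
    (hspan : Submodule.span ℝ (insert (realPoint ∅)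
        (realPoint '' {F ∈ allFaces Δ | f (realPoint F) = 0})) = ⊤) :
    coneFace Δ f ∈ facetsAvoidingLast Δ := by
  have hne : f ≠ 0 := fun h => by simp [h] at hf0
  refine ⟨⟨⟨f, hne, fun x hx => (nonneg_and_mem_hull hf hx).1, rfl⟩, ?_⟩, fun h => ?_⟩
  · rw [span_semigroupCone, finrank_top, Module.finrank_fin_fun]
    have hle : Module.finrank ℝ (Submodule.span ℝ (coneFace Δ f)) ≤ n := by
      refine le_trans (Submodule.finrank_mono ?_) (finrank_ker hne).le
      exact Submodule.span_le.2 fun x hx => hx.2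
    -- Adjoining the line through `e_{n+1}` fills the whole space, so the span of the face has
    -- codimension at most one.
    have hge : n + 1 ≤ 1 + Module.finrank ℝ (Submodule.span ℝ (coneFace Δ f)) := by
      have htop : Submodule.span ℝ {realPoint ∅} ⊔ Submodule.span ℝ (coneFace Δ f) = ⊤ := by
        rw [← top_le_iff, ← hspan, ← Submodule.span_union]
        refine Submodule.span_mono (Set.insert_subset (Or.inl rfl) ?_)
        rintro _ ⟨G, ⟨hG, hfG⟩, rfl⟩
        exact Or.inr ((realPoint_mem_coneFace hG).2 hfG)
      have h1 := Submodule.finrank_add_le_finrank_add_finrank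
        (Submodule.span ℝ {realPoint (∅ : Finset (Fin n))}) (Submodule.span ℝ (coneFace Δ f))
      rw [htop, finrank_top, Module.finrank_fin_fun] at h1
      have h2 := finrank_span_le_card (R := ℝ) {realPoint (∅ : Finset (Fin n))}
      simp only [Set.toFinset_singleton, Finset.card_singleton] at h2
      omega
    omega
  · rw [← realPoint_empty] at h
    exact hf0.ne' h.2

theorem tElem_mem_weightIdeal {f : (Fin (n + 1) → ℝ) →ₗ[ℝ] ℝ}
    {hf : ∀ F ∈ allFaces Δ, 0 ≤ f (realPoint F)} :
    tElem K Δ ∈ weightIdeal f hf ↔ f (realPoint ∅) ≠ 0 :=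
  faceElem_mem_weightIdeal (K := K) (empty_mem_allFaces (Δ := Δ))

/-- The order functional `f` of `P` vanishes exactly at the generators outside `P`. The rotated `g`
keeps these zeros, so its prime lies in `P`; it contains `t`, and minimality gives equality. -/
theorem exists_facet_of_mem_minimalPrimes {P : Ideal (toricRing K Δ)}
    (hP : P ∈ (Ideal.span {tElem K Δ}).minimalPrimes) :
    ∃ F ∈ facetsAvoidingLast Δ, facetIdeal K Δ F = P := by
  have htP : tElem K Δ ∈ P := hP.1.2 (Ideal.mem_span_singleton_self _)
  let Q : HeightOnePrime (toricRing K Δ) :=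
    ⟨⟨P, hP.1.1⟩, height_eq_one_of_mem_minimalPrimes tElem_ne_zero hP⟩
  obtain ⟨f, hf⟩ := exists_functional_natOrd Q
  have hnonneg : ∀ F ∈ allFaces Δ, 0 ≤ f (realPoint F) := by
    intro F hF
    rw [hf F hF]
    exact Nat.cast_nonneg _
  have hzero {F : Finset (Fin n)} (hF : F ∈ allFaces Δ) :
      f (realPoint F) = 0 ↔ faceElem K hF ∉ P := by
    rw [hf F hF, Nat.cast_eq_zero]
    exact natOrd_eq_zero_iff (P := Q) (faceElem_ne_zero hF)
  have hpos : 0 < f (realPoint ∅) :=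
    lt_of_le_of_ne (hnonneg ∅ empty_mem_allFaces)
      (Ne.symm fun h => (hzero empty_mem_allFaces).1 h htP)
  obtain ⟨g, hg, hg0, hfg, hspan⟩ := exists_facet_functional hnonneg hpos
  refine ⟨coneFace Δ g, coneFace_mem_facetsAvoidingLast hg hg0 hspan, ?_⟩
  rw [facetIdeal_coneFace hg]
  have hle : weightIdeal g hg ≤ P := by
    refine weightIdeal_le fun F hF h => ?_
    by_contra hFP
    exact h (hfg F hF ((hzero hF).2 hFP))
  refine le_antisymm hle (hP.2 ⟨isPrime_weightIdeal, ?_⟩ hle)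
  rw [Ideal.span_singleton_le_iff_mem]
  exact tElem_mem_weightIdeal.2 hg0.ne'

theorem bijOn_facetIdeal (K : Type*) [Field K] (Δ : AbstractSimplicialComplex (Fin n)) :
    Set.BijOn (facetIdeal K Δ) (facetsAvoidingLast Δ)
      (Ideal.span {tElem K Δ}).minimalPrimes := by
  refine ⟨fun F hF => ?_, fun F hF G hG h => ?_, fun P hP => exists_facet_of_mem_minimalPrimes hP⟩
  · obtain ⟨f, hf, rfl, hf0, hspan⟩ := exists_functional_of_mem_facetsAvoidingLast hF
    have hprime : (facetIdeal K Δ (coneFace Δ f)).IsPrime := by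
      rw [facetIdeal_coneFace hf]
      exact isPrime_weightIdeal
    have hle : Ideal.span {tElem K Δ} ≤ facetIdeal K Δ (coneFace Δ f) := by
      rw [Ideal.span_singleton_le_iff_mem, facetIdeal_coneFace hf]
      exact tElem_mem_weightIdeal.2 hf0
    obtain ⟨P, hP, hPle⟩ := Ideal.exists_minimalPrimes_le hle
    obtain ⟨G, hG, rfl⟩ := exists_facet_of_mem_minimalPrimes hP
    obtain ⟨g, hg, rfl, -, hspan'⟩ := exists_functional_of_mem_facetsAvoidingLast hG
    have hsub := coneFace_subset hf hg hPle
    -- Each facet spans the kernel of its functional, so nested facets have the same hyperplane by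
    -- dimension.
    have hker : LinearMap.ker f = LinearMap.ker g := by
      refine Submodule.eq_of_le_of_finrank_eq ?_ ?_
      · rw [← hspan, ← hspan']
        exact Submodule.span_mono hsub
      · rw [finrank_ker (fun h => hf0 (by simp [h])), finrank_ker]
        rintro rfl
        have h1 : tElem K Δ ∈ facetIdeal K Δ (coneFace Δ 0) :=
          hP.1.2 (Ideal.mem_span_singleton_self _)
        rw [facetIdeal_coneFace hg] at h1
        exact tElem_mem_weightIdeal.1 h1 rfl
    have heq : coneFace Δ f = coneFace Δ g := by
      refine hsub.antisymm fun x hx => ⟨hx.1, ?_⟩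
      rw [← LinearMap.mem_ker, hker]
      exact hx.2
    rwa [heq]
  · obtain ⟨f, hf, rfl, -, -⟩ := exists_functional_of_mem_facetsAvoidingLast hF
    obtain ⟨g, hg, rfl, -, -⟩ := exists_functional_of_mem_facetsAvoidingLast hG
    exact (coneFace_subset hf hg h.ge).antisymm (coneFace_subset hg hf h.le)

end Facets

end ToricComplex

end

theorem mainTheorem2 (K : Type*) [Field K] (n : ℕ) (Δ : AbstractSimplicialComplex (Fin n))
    (hnormal : IsIntegrallyClosed (ToricComplex.toricRing K Δ)) :
    (Ideal.span {ToricComplex.tElem K Δ}).minimalPrimes.Finite ∧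
    Module.Free ℤ (WeilDivisor.Cl (ToricComplex.toricRing K Δ)) ∧
    Module.Finite ℤ (WeilDivisor.Cl (ToricComplex.toricRing K Δ)) ∧
    Module.finrank ℤ (WeilDivisor.Cl (ToricComplex.toricRing K Δ)) + 1 =
      (Ideal.span {ToricComplex.tElem K Δ}).minimalPrimes.ncard ∧
    (ToricComplex.facetsAvoidingLast Δ).Finite ∧
    (ToricComplex.facetsAvoidingLast Δ).ncard =
      (Ideal.span {ToricComplex.tElem K Δ}).minimalPrimes.ncard := by
  have hfin := (Ideal.span {ToricComplex.tElem K Δ}).finite_minimalPrimes_of_isNoetherianRing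
  have hbij := ToricComplex.bijOn_facetIdeal K Δ
  obtain ⟨P₀, hP₀⟩ := ToricComplex.exists_natOrd_tElem_eq_one K Δ
  obtain ⟨hfree, hfinite, hrank⟩ := WeilDivisor.cl_free_of_localization
    ToricComplex.tElem_ne_zero hP₀ (fun a b ha hb h => ToricComplex.exists_eq_unit_mul ha hb h)
    (fun Q hQ => ToricComplex.exists_generator_away hQ)
  refine ⟨hfin, hfree, hfinite, hrank, ?_, ?_⟩
  · exact Set.Finite.of_finite_image (hbij.image_eq ▸ hfin) hbij.injOn
  · rw [← hbij.image_eq, hbij.injOn.ncard_image]
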